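/- For $\varphi\in L^1(\mathbb R)$ let $\widehat\varphi(x)=\int_{\mathbb R}e^{-ixt}\varphi(t)\,dt$, and let $\widehat f$ denote the Fourier transform of $f\in L^2(\mathbb R)$ in the same normalisation. Let $0<\beta<\frac13$ and $q>\frac12$. Let $\varphi_0\in L^1(\mathbb R)$ be not almost everywhere zero, let $f_0,g_0\in L^2(\mathbb R)$ satisfy $\int_{\mathbb R}f_0(t-s)\varphi_0(s)\,ds=g_0(t)$ for almost every $t$, and suppose that for some constant $C$ $$|\widehat{f_0}(\lambda)|^2\le C(1+\lambda^2)^{-q}\quad\text{for almost every }\lambda\in\mathbb R .$$ Put $p(s)=-\log\int_{|t|\ge s}|\varphi_0(t)|\,dt\in(-\infty,+\infty]$ and assume $p(s)/s\to\infty$ as $s\to\infty$. For $\epsilon>0$ put $s_\epsilon=\inf\{s>0: e^{-p(s)}\le\epsilon\}$ and $\delta_\epsilon=(C_1/C_2)^{1/4}\epsilon^{(1+3\beta)/2}$, where $C_1=4(1+\|g_0\|_{L^2}^2+\|\varphi_0\|_{L^1}^2)$ and $C_2=1+\|g_0\|_{L^2}^2$. Then for all sufficiently small $\epsilon>0$ there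 is exactly one $R_\epsilon>0$ with $$\Big[(q+\tfrac12)\log R_\epsilon+\log(15e^3)\Big]\Big[\log\|\varphi_0\|_{L^1}+2e\,s_\epsilon R_\epsilon\Big]=-\log(\epsilon^\beta+\epsilon)$$ whose first factor is positive (for $\|\varphi_0\|_{L^1}\ge1$ and small $\epsilon$ the positivity is automatic), and the following hold. (i) $R_\epsilon\to\infty$ as $\epsilon\to0^+$. (ii) There is a constant $C_3>0$, independent of $\epsilon$, such that for all sufficiently small $\epsilon>0$ and all $\varphi_\epsilon\in L^1(\mathbb R)$, $g_\epsilon\in L^2(\mathbb R)$ with $\|\varphi_0-\varphi_\epsilon\|_{L^1}\le\epsilon$ and $\|g_0-g_\epsilon\|_{L^2}\le\epsilon$, the function $f_\epsilon\in L^2(\mathbb R)$ with $$\widehat{f_\epsilon}=\frac{\widehat{g_\epsilon}\,\overline{\widehat{\varphi_\epsilon}}}{\delta_\epsilon+|\widehat{\varphi_\epsilon}|^2}$$ satisfies $\|f_0-f_\epsilon\|_{L^2}\le C_3R_\epsilon^{-q+1/2}$. (iii) If $\varphi_0$ has compact support, then $s_\epsilon$ is bounded for $\epsilon>0$ small enough,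 and $\displaystyle\lim_{\epsilon\to0^+}\frac{\log R_\epsilon}{\log\log(1/\epsilon)}=1$. -/

import Mathlib

open Filter Topology MeasureTheory FourierTransform
open scoped ENNReal

noncomputable section

namespace Deconvolution

/-- The space `L²(ℝ)` of complex valued functions, with respect to Lebesgue measure. -/
abbrev L2 : Type := Lp ℂ 2 (volume : Measure ℝ)

/-- The Fourier transform `φ̂(x) = ∫ e^{-ixt} φ(t) dt` of an integrable function. -/
def hat (φ : ℝ → ℂ) (x : ℝ) : ℂ :=
  ∫ t : ℝ, Complex.exp (-(Complex.I * x * t)) * φ t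

/-- The (Plancherel) Fourier transform of `f ∈ L²(ℝ)` in the normalisation
`f̂(x) = ∫ e^{-ixt} f(t) dt`. Mathlib's `𝓕` uses the character `e^{-2πixt}`, whence the
rescaling of the variable. The function is determined up to a null set. -/
def hat2 (f : L2) (x : ℝ) : ℂ :=
  (𝓕 f : L2) (x / (2 * Real.pi))

/-- The norm of an integrable function in `L¹(ℝ)`. -/
def norm1 (φ : ℝ → ℂ) : ℝ := ∫ t : ℝ, ‖φ t‖

/-- `p(s) = -log ∫_{|t| ≥ s} |φ(t)| dt`, with values in the extended reals
(so `p(s) = +∞` if `φ` vanishes almost everywhere on `|t| ≥ s`). -/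
def p (φ : ℝ → ℂ) (s : ℝ) : EReal :=
  -ENNReal.log (∫⁻ t in {t : ℝ | s ≤ |t|}, ‖φ t‖ₑ)

/-- `s_ε = inf {s > 0 : e^{-p(s)} ≤ ε}`. -/
def cutoff (φ : ℝ → ℂ) (ε : ℝ) : ℝ :=
  sInf {s : ℝ | 0 < s ∧ EReal.exp (-p φ s) ≤ ENNReal.ofReal ε}

/-- `f` solves the convolution equation `∫ f(t - s) φ(s) ds = g(t)`. -/
def IsSolution (φ : ℝ → ℂ) (f g : L2) : Prop :=
  ∀ᵐ t : ℝ, ∫ s : ℝ, f (t - s) * φ s = g t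

/-- `f` is the Tikhonov approximation with parameter `δ` built from the data `(φ, g)`:
the function of `L²(ℝ)` whose Fourier transform is `ĝ · conj φ̂ / (δ + |φ̂|²)`. -/
def IsTikhonov (δ : ℝ) (φ : ℝ → ℂ) (g f : L2) : Prop :=
  ∀ᵐ x : ℝ, hat2 f x =
    hat2 g x * (starRingEnd ℂ) (hat φ x) / ((δ + ‖hat φ x‖ ^ 2 : ℝ) : ℂ)

/-- `C₁ = 4 (1 + ‖g₀‖² + ‖φ₀‖²)`. -/
def C1 (φ₀ : ℝ → ℂ) (g₀ : L2) : ℝ := 4 * (1 + ‖g₀‖ ^ 2 + norm1 φ₀ ^ 2)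

/-- `C₂ = 1 + ‖g₀‖²`. -/
def C2 (g₀ : L2) : ℝ := 1 + ‖g₀‖ ^ 2

/-- The regularization parameter `δ_ε = (C₁ / C₂)^{1/4} ε^{(1 + 3β)/2}`. -/
def delta (φ₀ : ℝ → ℂ) (g₀ : L2) (β ε : ℝ) : ℝ :=
  (C1 φ₀ g₀ / C2 g₀) ^ (1 / 4 : ℝ) * ε ^ ((1 + 3 * β) / 2)

/-- `R > 0` solves
`[(q + 1/2) log R + log (15 e³)] [log ‖φ‖₁ + 2 e s_ε R] = -log (ε^β + ε)`.
The first factor is required to be positive. If `‖φ‖₁ ≥ 1` this is automatic for small `ε`; if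
`‖φ‖₁ < 1` it discards the spurious solution near `R = 0` at which both factors are negative. -/
def IsRadius (φ : ℝ → ℂ) (q β ε R : ℝ) : Prop :=
  0 < R ∧
  0 < (q + 1 / 2) * Real.log R + Real.log (15 * Real.exp 3) ∧
  ((q + 1 / 2) * Real.log R + Real.log (15 * Real.exp 3)) *
      (Real.log (norm1 φ) + 2 * Real.exp 1 * cutoff φ ε * R) = -Real.log (ε ^ β + ε)

/-- `φ` (as a class of functions modulo null sets) has compact support. -/
def HasCompactSupp (φ : ℝ → ℂ) : Prop :=
  ∃ A : ℝ, ∀ᵐ t : ℝ, A < |t| → φ t = 0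

end Deconvolution

end

/-
The pointwise identity for the Tikhonov quotient bounds its error by `|f̂₀|` where `|φ̂_ε|` is
small and by powers of `ε` elsewhere. The former set lies in `{|x| > R_ε}`, where the decay of
`f̂₀` applies, together with the set of `|x| ≤ R_ε` at which the Fourier transform of `φ₀`
restricted to `[-s_ε, s_ε]` is at most `ε^β + ε`. This transform is entire of exponential type
`s_ε`, and a Remez type inequality (divide out the zeros in a disc by a Blaschke product, then
interpolate at well separated points of the set) turns the equation for `R_ε` into the statement
that the set has measure at most `R_ε^{1-2q}`. Both pieces then contribute `O(R_ε^{1/2-q})` to the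
error. Since `R_ε` grows at most like `log (1/ε)`, the powers of `ε` are negligible.
-/

namespace Deconvolution

theorem exists_blaschke_quotient {G : ℂ → ℂ} (hG : Differentiable ℂ G) {a : ℂ} (ha : G a = 0)
    {ρ : ℝ} (hρ : 0 < ρ) :
    ∃ H : ℂ → ℂ, Differentiable ℂ H ∧ (∀ x, x ≠ a → G x = 0 → H x = 0) ∧
      (∀ z, ‖z‖ = ρ → ‖H z‖ = ‖G z‖) ∧ ‖G 0‖ = ‖a‖ / ρ * ‖H 0‖ := by
  have hfactor : ∀ z, G z = (z - a) * dslope G a z := fun z => by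
    simpa [ha] using (sub_smul_dslope G a z).symm
  have hslope : Differentiable ℂ (dslope G a) := differentiableOn_univ.1 <|
    (Complex.differentiableOn_dslope univ_mem).2 hG.differentiableOn
  refine ⟨fun z => dslope G a z * ((ρ ^ 2 - (starRingEnd ℂ) a * z) / ρ), by fun_prop,
    fun x hxa hx => ?_, fun z hz => ?_, ?_⟩
  · have : dslope G a x = 0 := by simpa [hfactor x, sub_ne_zero.2 hxa] using hx
    simp [this]
  · have hconj : (ρ : ℂ) ^ 2 - (starRingEnd ℂ) a * z = (starRingEnd ℂ) (z - a) * z := by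
      rw [map_sub, sub_mul, Complex.conj_mul', hz]
    simp only [hfactor z, hconj, norm_mul, norm_div, RCLike.norm_conj, hz, Complex.norm_real,
      Real.norm_of_nonneg hρ.le]
    field_simp
  · simp only [hfactor 0, mul_zero, sub_zero, zero_sub, norm_mul, norm_neg, norm_div, norm_pow,
      Complex.norm_real, Real.norm_of_nonneg hρ.le]
    field_simp

theorem norm_apply_zero_le_of_zeros {G : ℂ → ℂ} (hG : Differentiable ℂ G) {S : Finset ℂ}
    (hS : ∀ x ∈ S, G x = 0) {ρ M : ℝ} (hρ : 0 < ρ) (hM : ∀ z, ‖z‖ = ρ → ‖G z‖ ≤ M) :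
    ‖G 0‖ ≤ M * ∏ x ∈ S, (‖x‖ / ρ) := by
  induction S using Finset.induction_on generalizing G with
  | empty =>
    rw [Finset.prod_empty, mul_one]
    refine Complex.norm_le_of_forall_mem_frontier_norm_le (U := Metric.ball 0 ρ)
      Metric.isBounded_ball hG.diffContOnCl (fun z hz => hM z ?_)
      (subset_closure (Metric.mem_ball_self hρ))
    simpa [frontier_ball _ hρ.ne'] using hz
  | insert a S ha ih =>
    obtain ⟨H, hH, hHzero, hHcircle, hH0⟩ :=
      exists_blaschke_quotient hG (hS a (Finset.mem_insert_self a S)) hρ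
    have hHS : ∀ x ∈ S, H x = 0 := fun x hx =>
      hHzero x (ne_of_mem_of_not_mem hx ha) (hS x (Finset.mem_insert_of_mem hx))
    rw [Finset.prod_insert ha, hH0]
    calc ‖a‖ / ρ * ‖H 0‖ ≤ ‖a‖ / ρ * (M * ∏ x ∈ S, (‖x‖ / ρ)) := by
          gcongr
          exact ih hH hHS fun z hz => (hHcircle z hz).trans_le (hM z hz)
      _ = M * (‖a‖ / ρ * ∏ x ∈ S, (‖x‖ / ρ)) := by ring

theorem volume_le_ofReal_add_volume_inter_Ici {E : Set ℝ} {y : ℝ} (hy : y ∈ lowerBounds E)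
    (d : ℝ) : volume E ≤ ENNReal.ofReal d + volume (E ∩ Set.Ici (y + d)) := by
  have hsub : E ⊆ Set.Ico y (y + d) ∪ E ∩ Set.Ici (y + d) := fun z hz =>
    (lt_or_ge z (y + d)).imp (fun h => ⟨hy hz, h⟩) fun h => ⟨hz, h⟩
  calc volume E ≤ volume (Set.Ico y (y + d)) + volume (E ∩ Set.Ici (y + d)) :=
        (measure_mono hsub).trans (measure_union_le _ _)
    _ = _ := by rw [Real.volume_Ico, add_sub_cancel_left]

theorem exists_separated_points {d : ℝ} (hd : 0 ≤ d) (n : ℕ) {E : Set ℝ} (hE : IsCompact E)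
    (hvol : ENNReal.ofReal (n * d) < volume E) :
    ∃ x : ℕ → ℝ, (∀ i ≤ n, x i ∈ E) ∧ ∀ i j, i ≤ j → j ≤ n → ((j : ℝ) - i) * d ≤ x j - x i := by
  obtain ⟨y, hyE, hy⟩ := hE.exists_isLeast
    (nonempty_of_measure_ne_zero (zero_le.trans_lt hvol).ne')
  induction n generalizing E y with
  | zero =>
    refine ⟨fun _ => y, fun _ _ => hyE, fun i j hij hj => ?_⟩
    obtain rfl : i = j := by omega
    simp
  | succ n ih =>
    have hvol' : ENNReal.ofReal (n * d) < volume (E ∩ Set.Ici (y + d)) := by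
      have hsplit : ENNReal.ofReal ((n + 1 : ℕ) * d) =
          ENNReal.ofReal d + ENNReal.ofReal (n * d) := by
        rw [← ENNReal.ofReal_add hd (by positivity), Nat.cast_succ, add_one_mul, add_comm]
      rw [hsplit] at hvol
      exact (ENNReal.add_lt_add_iff_left ENNReal.ofReal_ne_top).1
        (hvol.trans_le (volume_le_ofReal_add_volume_inter_Ici hy d))
    have hcompact : IsCompact (E ∩ Set.Ici (y + d)) := hE.inter_right isClosed_Ici
    obtain ⟨y', hyE', hy'⟩ := hcompact.exists_isLeast
      (nonempty_of_measure_ne_zero (zero_le.trans_lt hvol').ne')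
    obtain ⟨x, hxE, hx⟩ := ih hcompact hvol' y' hyE' hy'
    refine ⟨fun i => Nat.casesOn i y x, ?_, ?_⟩
    · rintro (_ | i) hi
      exacts [hyE, (hxE i (by omega)).1]
    · rintro (_ | i) (_ | j) hij hj
      · simp
      · have h0j := hx 0 j (Nat.zero_le j) (by omega)
        have h0 : y + d ≤ x 0 := (hxE 0 (Nat.zero_le n)).2
        change (((j + 1 : ℕ) : ℝ) - (0 : ℕ)) * d ≤ x j - y
        push_cast at h0j ⊢
        linarith
      · omega
      · simpa using hx i j (by omega) (by omega)

theorem prod_abs_sub_eq_factorial_mul {n j : ℕ} (hj : j ≤ n) :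
    ∏ i ∈ (Finset.range (n + 1)).erase j, |(j : ℝ) - i| = j.factorial * (n - j).factorial := by
  have hsplit : (Finset.range (n + 1)).erase j = Finset.range j ∪ Finset.Ico (j + 1) (n + 1) := by
    ext i; simp; omega
  have hdisj : Disjoint (Finset.range j) (Finset.Ico (j + 1) (n + 1)) := by
    rw [Finset.disjoint_left]; intro i; simp; omega
  rw [hsplit, Finset.prod_union hdisj]
  congr 1
  · rw [← Finset.prod_range_reflect, ← Finset.prod_range_add_one_eq_factorial, Nat.cast_prod]
    refine Finset.prod_congr rfl fun i hi => ?_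
    have hij : i + 1 ≤ j := by simpa using hi
    rw [Nat.sub_sub, add_comm 1 i, Nat.cast_sub hij, sub_sub_cancel, abs_of_nonneg (by positivity)]
  · rw [Finset.prod_Ico_eq_prod_range, ← Finset.prod_range_add_one_eq_factorial,
      Nat.add_sub_add_right, Nat.cast_prod]
    refine Finset.prod_congr rfl fun i _ => ?_
    push_cast
    rw [abs_of_nonpos] <;> linarith [Nat.cast_nonneg (α := ℝ) i]

theorem factorial_le_two_pow_mul {n j : ℕ} (hj : j ≤ n) :
    n.factorial ≤ 2 ^ n * (j.factorial * (n - j).factorial) := by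
  rw [← Nat.choose_mul_factorial_mul_factorial hj, mul_assoc]
  exact Nat.mul_le_mul_right _ (Nat.choose_le_two_pow n j)

theorem norm_eval_basis_le {v : ℕ → ℂ} {n j : ℕ} {d r : ℝ} (hd : 0 < d)
    (hv : ∀ i ≤ n, ∀ k ≤ n, |(i : ℝ) - k| * d ≤ ‖v i - v k‖) (hj : j ≤ n) {z : ℂ}
    (hz : ∀ i ≤ n, ‖z - v i‖ ≤ r) :
    ‖(Lagrange.basis (Finset.range (n + 1)) v j).eval z‖ ≤ (2 * r / d) ^ n / n.factorial := by
  have hr : 0 ≤ r := (norm_nonneg _).trans (hz 0 n.zero_le)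
  have hcard : ((Finset.range (n + 1)).erase j).card = n := by
    rw [Finset.card_erase_of_mem (Finset.mem_range.2 (by omega))]; simp
  have hfactor : ∀ i ∈ (Finset.range (n + 1)).erase j,
      ‖(Lagrange.basisDivisor (v j) (v i)).eval z‖ ≤ r / (|(j : ℝ) - i| * d) := by
    intro i hi
    obtain ⟨hij, hin⟩ := Finset.mem_erase.1 hi
    have hi : i ≤ n := by simpa [Nat.lt_succ_iff] using hin
    have hpos : 0 < |(j : ℝ) - i| :=
      abs_pos.2 (sub_ne_zero.2 (by exact_mod_cast Ne.symm hij))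
    simp only [Lagrange.basisDivisor, Polynomial.eval_mul, Polynomial.eval_C, Polynomial.eval_sub,
      Polynomial.eval_X, norm_mul, norm_inv]
    rw [inv_mul_eq_div]
    exact div_le_div₀ hr (hz i hi) (by positivity) (hv j hj i hi)
  have hfact : (n.factorial : ℝ) ≤ 2 ^ n * (j.factorial * (n - j).factorial) := by
    exact_mod_cast factorial_le_two_pow_mul hj
  calc ‖(Lagrange.basis (Finset.range (n + 1)) v j).eval z‖
      ≤ ∏ i ∈ (Finset.range (n + 1)).erase j, r / (|(j : ℝ) - i| * d) := by
        rw [Lagrange.basis, Polynomial.eval_prod, norm_prod]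
        exact Finset.prod_le_prod (fun _ _ => norm_nonneg _) hfactor
    _ = (r / d) ^ n / (j.factorial * (n - j).factorial) := by
        rw [← prod_abs_sub_eq_factorial_mul hj, Finset.prod_div_distrib, Finset.prod_mul_distrib,
          Finset.prod_const, Finset.prod_const, hcard, div_pow, div_div, mul_comm (d ^ n)]
    _ ≤ (2 * r / d) ^ n / n.factorial := by
        rw [div_le_div_iff₀ (by positivity) (by positivity), mul_div_assoc, mul_pow,
          mul_comm (2 ^ n), mul_assoc]
        gcongr

theorem norm_eval_interpolate_le {v w : ℕ → ℂ} {n : ℕ} {d r δ : ℝ} (hd : 0 < d)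
    (hv : ∀ i ≤ n, ∀ k ≤ n, |(i : ℝ) - k| * d ≤ ‖v i - v k‖) (hw : ∀ i ≤ n, ‖w i‖ ≤ δ) {z : ℂ}
    (hz : ∀ i ≤ n, ‖z - v i‖ ≤ r) :
    ‖(Lagrange.interpolate (Finset.range (n + 1)) v w).eval z‖ ≤
      (n + 1) * (δ * ((2 * r / d) ^ n / n.factorial)) := by
  have hδ : 0 ≤ δ := (norm_nonneg _).trans (hw 0 n.zero_le)
  have hcard : ((n : ℝ) + 1) * (δ * ((2 * r / d) ^ n / n.factorial)) =
      ∑ _j ∈ Finset.range (n + 1), δ * ((2 * r / d) ^ n / n.factorial) := by simp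
  rw [Lagrange.interpolate_apply, Polynomial.eval_finsetSum, hcard]
  refine norm_sum_le_of_le _ fun j hj => ?_
  have hjn : j ≤ n := by simpa [Nat.lt_succ_iff] using hj
  rw [Polynomial.eval_mul, Polynomial.eval_C, norm_mul]
  gcongr
  exacts [hw j hjn, norm_eval_basis_le hd hv hjn hz]

theorem succ_pow_succ_le_exp_mul_factorial (n : ℕ) :
    ((n : ℝ) + 1) ^ (n + 1) ≤ Real.exp 2 ^ (n + 1) * n.factorial := by
  have hpow : ((n : ℝ) + 1) ^ (n + 1) ≤ Real.exp (n + 1) * (n + 1).factorial :=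
    (div_le_iff₀ (by positivity)).1 (Real.pow_div_factorial_le_exp _ (by positivity) (n + 1))
  have hexp : Real.exp 2 ^ (n + 1) = Real.exp (n + 1) * Real.exp (n + 1) := by
    rw [← Real.exp_nat_mul, ← Real.exp_add]; push_cast; ring_nf
  calc ((n : ℝ) + 1) ^ (n + 1) ≤ Real.exp (n + 1) * ((n + 1) * n.factorial) := by
        exact_mod_cast hpow
    _ ≤ Real.exp (n + 1) * (Real.exp (n + 1) * n.factorial) := by
        gcongr
        linarith [Real.add_one_le_exp ((n : ℝ) + 1)]
    _ = Real.exp 2 ^ (n + 1) * n.factorial := by rw [hexp, mul_assoc]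

theorem norm_apply_zero_le_of_interpolate {ι : Type*} [DecidableEq ι] {f : ℂ → ℂ}
    (hf : Differentiable ℂ f) {s : Finset ι} {v : ι → ℂ} (hv : Set.InjOn v s) {R M Λ : ℝ}
    (hR : 0 < R) (hvR : ∀ i ∈ s, ‖v i‖ ≤ R) (hM : ∀ z, ‖z‖ = Real.exp 1 * R → ‖f z‖ ≤ M)
    (hΛ : ∀ z, ‖z‖ ≤ Real.exp 1 * R → ‖(Lagrange.interpolate s v (f ∘ v)).eval z‖ ≤ Λ) :
    ‖f 0‖ ≤ M * Real.exp (-s.card) + 2 * Λ := by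
  set P := Lagrange.interpolate s v (f ∘ v)
  have hzero : ∀ w ∈ s.image v, f w - P.eval w = 0 := by
    intro w hw
    obtain ⟨i, hi, rfl⟩ := Finset.mem_image.1 hw
    rw [Lagrange.eval_interpolate_at_node _ hv hi, Function.comp_apply, sub_self]
  have hcircle : ∀ z, ‖z‖ = Real.exp 1 * R → ‖f z - P.eval z‖ ≤ M + Λ := fun z hz =>
    (norm_sub_le _ _).trans (add_le_add (hM z hz) (hΛ z hz.le))
  have hprod : ∏ w ∈ s.image v, (‖w‖ / (Real.exp 1 * R)) ≤ Real.exp (-s.card) := by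
    rw [Finset.prod_image hv]
    calc ∏ i ∈ s, (‖v i‖ / (Real.exp 1 * R)) ≤ ∏ _i ∈ s, Real.exp (-1) := by
          refine Finset.prod_le_prod (fun _ _ => by positivity) fun i hi => ?_
          rw [div_le_iff₀ (by positivity), ← mul_assoc, ← Real.exp_add]
          simpa using hvR i hi
      _ = Real.exp (-s.card) := by rw [Finset.prod_const, ← Real.exp_nat_mul, mul_neg_one]
  have hcirclePoint : ‖((Real.exp 1 * R : ℝ) : ℂ)‖ = Real.exp 1 * R :=
    Complex.norm_of_nonneg (by positivity)
  have hM₀ : 0 ≤ M := (norm_nonneg _).trans (hM _ hcirclePoint)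
  have hΛ₀ : 0 ≤ Λ := (norm_nonneg _).trans (hΛ _ hcirclePoint.le)
  have hexp : Real.exp (-(s.card : ℝ)) ≤ 1 := Real.exp_le_one_iff.2 (by simp)
  calc ‖f 0‖ ≤ ‖f 0 - P.eval 0‖ + ‖P.eval 0‖ := norm_le_norm_sub_add _ _
    _ ≤ (M + Λ) * Real.exp (-s.card) + Λ := by
        gcongr
        · exact (norm_apply_zero_le_of_zeros (hf.sub P.differentiable) hzero (by positivity)
            hcircle).trans (by gcongr)
        · exact hΛ 0 (by rw [norm_zero]; positivity)
    _ ≤ M * Real.exp (-s.card) + 2 * Λ := by nlinarith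

theorem le_two_mul_of_ofReal_le_volume {E : Set ℝ} {m R : ℝ} (hm : 0 < m)
    (hER : ∀ x ∈ E, |x| ≤ R) (hvol : ENNReal.ofReal m ≤ volume E) : m ≤ 2 * R := by
  have hle : ENNReal.ofReal m ≤ ENNReal.ofReal (2 * R) := by
    refine hvol.trans ((measure_mono fun x hx => abs_le.1 (hER x hx)).trans_eq ?_)
    change volume (Set.Icc (-R) R) = _
    rw [Real.volume_Icc, sub_neg_eq_add, ← two_mul]
  by_contra! h
  exact hle.not_gt ((ENNReal.ofReal_lt_ofReal_iff hm).2 h)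

theorem abs_sub_mul_le_norm_sub {x : ℕ → ℝ} {d : ℝ} {n : ℕ}
    (hx : ∀ i j, i ≤ j → j ≤ n → ((j : ℝ) - i) * d ≤ x j - x i) :
    ∀ i ≤ n, ∀ j ≤ n, |(i : ℝ) - j| * d ≤ ‖(x i : ℂ) - x j‖ := by
  intro i hi j hj
  wlog hij : j ≤ i generalizing i j
  · rw [abs_sub_comm, norm_sub_rev]
    exact this j hj i hi (le_of_not_ge hij)
  rw [← Complex.ofReal_sub, Complex.norm_real,
    abs_of_nonneg (sub_nonneg.2 (by exact_mod_cast hij))]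
  exact (hx j i hij hi).trans (le_abs_self _)

theorem injOn_of_abs_sub_mul_le {v : ℕ → ℂ} {d : ℝ} (hd : 0 < d) {n : ℕ}
    (hv : ∀ i ≤ n, ∀ j ≤ n, |(i : ℝ) - j| * d ≤ ‖v i - v j‖) :
    Set.InjOn v (Finset.range (n + 1)) := by
  intro i hi j hj hij
  have hle := hv i (by simpa [Nat.lt_succ_iff] using hi) j (by simpa [Nat.lt_succ_iff] using hj)
  rw [hij, sub_self, norm_zero] at hle
  have habs : |(i : ℝ) - j| = 0 := le_antisymm (nonpos_of_mul_nonpos_left hle hd) (abs_nonneg _)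
  exact_mod_cast sub_eq_zero.1 (abs_eq_zero.1 habs)

theorem succ_mul_div_factorial_le {m R δ : ℝ} (hm : 0 < m) (hmR : m ≤ 8 * R) (hδ : 0 ≤ δ) (k : ℕ) :
    ((k : ℝ) + 1) * (δ * ((2 * (4 * R) / (m / (k + 1))) ^ k / k.factorial)) ≤
      δ * (8 * Real.exp 2 * R / m) ^ (k + 1) := by
  have hle : 1 ≤ 8 * R / m := (one_le_div hm).2 hmR
  have hbase : 2 * (4 * R) / (m / (k + 1)) = 8 * R / m * ((k : ℝ) + 1) := by field_simp; ring
  calc ((k : ℝ) + 1) * (δ * ((2 * (4 * R) / (m / (k + 1))) ^ k / k.factorial))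
      = δ * (8 * R / m) ^ k * (((k : ℝ) + 1) ^ (k + 1) / k.factorial) := by
        rw [hbase, mul_pow]; ring
    _ ≤ δ * (8 * R / m) ^ (k + 1) * Real.exp 2 ^ (k + 1) := by
        gcongr
        · exact k.le_succ
        · rw [div_le_iff₀ (by positivity)]
          exact succ_pow_succ_le_exp_mul_factorial k
    _ = δ * (8 * Real.exp 2 * R / m) ^ (k + 1) := by rw [mul_assoc, ← mul_pow]; ring

theorem norm_apply_zero_le_of_small_on {f : ℂ → ℂ} (hf : Differentiable ℂ f) {R m M δ : ℝ}
    (hm : 0 < m) {E : Set ℝ} (hE : IsCompact E) (hER : ∀ x ∈ E, |x| ≤ R)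
    (hvol : ENNReal.ofReal m ≤ volume E) (hM : ∀ z, ‖z‖ = Real.exp 1 * R → ‖f z‖ ≤ M)
    (hδ : ∀ x ∈ E, ‖f x‖ ≤ δ) {n : ℕ} (hn : n ≠ 0) :
    ‖f 0‖ ≤ M * Real.exp (-n) + 2 * (δ * (8 * Real.exp 2 * R / m) ^ n) := by
  obtain ⟨k, rfl : n = k + 1⟩ := Nat.exists_eq_succ_of_ne_zero hn
  have hmR := le_two_mul_of_ofReal_le_volume hm hER hvol
  have hR : 0 < R := by linarith
  have hd : 0 < m / (k + 1) := by positivity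
  have hkd : ENNReal.ofReal (k * (m / (k + 1))) < volume E := by
    refine lt_of_lt_of_le ((ENNReal.ofReal_lt_ofReal_iff hm).2 ?_) hvol
    rw [mul_div_assoc', div_lt_iff₀ (by positivity)]
    linarith
  obtain ⟨x, hxE, hx⟩ := exists_separated_points hd.le k hE hkd
  have hsep := abs_sub_mul_le_norm_sub hx
  have hxR : ∀ i ≤ k, ‖(x i : ℂ)‖ ≤ R := fun i hi => by
    simpa [Complex.norm_real] using hER _ (hxE i hi)
  rw [← Finset.card_range (k + 1)]
  refine norm_apply_zero_le_of_interpolate hf (injOn_of_abs_sub_mul_le hd hsep) hR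
    (fun i hi => hxR i (by simpa [Nat.lt_succ_iff] using hi)) hM fun z hz => ?_
  have hdist : ∀ i ≤ k, ‖z - x i‖ ≤ 4 * R := fun i hi =>
    (norm_sub_le _ _).trans (by nlinarith [hxR i hi, Real.exp_one_lt_d9])
  rw [Finset.card_range]
  exact (norm_eval_interpolate_le hd hsep (fun i hi => hδ _ (hxE i hi)) hdist).trans
    (succ_mul_div_factorial_le hm (by linarith) ((norm_nonneg _).trans (hδ _ (hxE 0 k.zero_le))) k)

theorem norm_apply_le_of_small_on {f : ℂ → ℂ} (hf : Differentiable ℂ f) {R m M δ x₀ : ℝ}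
    (hm : 0 < m) {E : Set ℝ} (hE : IsCompact E) (hER : ∀ x ∈ E, |x - x₀| ≤ R)
    (hvol : ENNReal.ofReal m ≤ volume E) (hM : ∀ z : ℂ, ‖z - x₀‖ = Real.exp 1 * R → ‖f z‖ ≤ M)
    (hδ : ∀ x ∈ E, ‖f x‖ ≤ δ) {n : ℕ} (hn : n ≠ 0) :
    ‖f x₀‖ ≤ M * Real.exp (-n) + 2 * (δ * (8 * Real.exp 2 * R / m) ^ n) := by
  have htranslate := norm_apply_zero_le_of_small_on (f := fun z => f (z + x₀)) (E := (· + x₀) ⁻¹' E)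
    (hf.comp (by fun_prop)) hm ((Homeomorph.addRight x₀).isCompact_preimage.2 hE)
    (fun x hx => by simpa using hER _ hx) (by rwa [measure_preimage_add_right])
    (fun z hz => hM _ (by simpa using hz)) (fun x hx => by simpa using hδ _ hx) hn
  simpa using htranslate

theorem quarter_lt_of_small_on {F : ℂ → ℂ} (hF : Differentiable ℂ F) {N s a R m δ x₀ : ℝ}
    (hs : 0 < s) (hN : ∀ z, ‖F z‖ ≤ N * Real.exp (s * |z.im|)) (ha : 0 < a) (hax : a ≤ ‖F x₀‖)
    (hx₀ : |x₀| ≤ R) (hm : 0 < m) {E : Set ℝ} (hE : IsCompact E) (hER : ∀ x ∈ E, |x| ≤ R)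
    (hvol : ENNReal.ofReal m ≤ volume E) (hδ : ∀ x ∈ E, ‖F x‖ ≤ δ) {n : ℕ}
    (hn : s * (Real.exp 1 * (R + |x₀|)) + Real.log (4 * N / a) ≤ n) :
    a / 4 < δ * (16 * Real.exp 2 * R / m) ^ n := by
  have haN : a ≤ N := by simpa using hax.trans (hN x₀)
  have hN₀ : 0 < N := ha.trans_le haN
  have hR : 0 < R := by linarith [le_two_mul_of_ofReal_le_volume hm hER hvol]
  have : 0 < R + |x₀| := by positivity
  have hlog : 0 ≤ Real.log (4 * N / a) := Real.log_nonneg ((one_le_div ha).2 (by linarith))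
  have hn₀ : n ≠ 0 := by
    rintro rfl
    have : 0 < s * (Real.exp 1 * (R + |x₀|)) := by positivity
    rw [Nat.cast_zero] at hn
    linarith
  obtain ⟨y, hy⟩ := nonempty_of_measure_ne_zero
    ((ENNReal.ofReal_pos.2 hm).trans_le hvol).ne'
  have hδ₀ : 0 ≤ δ := (norm_nonneg _).trans (hδ y hy)
  have hmain : ‖F x₀‖ ≤ N * Real.exp (s * (Real.exp 1 * (R + |x₀|))) * Real.exp (-n) +
      2 * (δ * (8 * Real.exp 2 * (R + |x₀|) / m) ^ n) := by
    refine norm_apply_le_of_small_on hF hm hE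
      (fun x hx => (abs_sub _ _).trans (by gcongr; exact hER x hx)) hvol
      (fun z hz => (hN z).trans ?_) hδ hn₀
    gcongr
    simpa [← hz] using Complex.abs_im_le_norm (z - x₀)
  have hfirst : N * Real.exp (s * (Real.exp 1 * (R + |x₀|))) * Real.exp (-n) ≤ a / 4 :=
    calc N * Real.exp (s * (Real.exp 1 * (R + |x₀|))) * Real.exp (-n)
        ≤ N * Real.exp (-Real.log (4 * N / a)) := by
          rw [mul_assoc, ← Real.exp_add]
          gcongr
          linarith
      _ = a / 4 := by
          rw [Real.exp_neg, Real.exp_log (by positivity)]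
          field_simp
  have hbase : 8 * Real.exp 2 * (R + |x₀|) / m ≤ 16 * Real.exp 2 * R / m := by
    gcongr ?_ / m
    nlinarith [Real.exp_pos 2]
  have hsecond : δ * (8 * Real.exp 2 * (R + |x₀|) / m) ^ n ≤ δ * (16 * Real.exp 2 * R / m) ^ n := by
    gcongr
  linarith

/-- The factor `(q + 1/2) log R + log (15 e³)` of the equation that determines `R_ε`. -/
noncomputable def radiusFactor (q R : ℝ) : ℝ :=
  (q + 1 / 2) * Real.log R + Real.log (15 * Real.exp 3)

/-- The left-hand side of the equation that determines `R_ε`, with `L` in the place of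
`log ‖φ₀‖₁` and `s` in the place of `s_ε`. -/
noncomputable def radiusFun (q L s R : ℝ) : ℝ :=
  radiusFactor q R * (L + 2 * Real.exp 1 * s * R)

theorem eventually_log_add_le (a b : ℝ) {c : ℝ} (hc : 0 < c) :
    ∀ᶠ R : ℝ in atTop, a * Real.log R + b ≤ c * R := by
  have hlittle : (fun R : ℝ => a * Real.log R + b) =o[atTop] (id : ℝ → ℝ) :=
    (Real.isLittleO_log_id_atTop.const_mul_left a).add (Asymptotics.isLittleO_const_id_atTop b)
  filter_upwards [hlittle.def hc, eventually_ge_atTop 0] with R hR hR₀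
  rw [id, Real.norm_of_nonneg hR₀] at hR
  exact (le_abs_self _).trans hR

theorem eventually_mul_log_add_le_radiusFun {q s₁ : ℝ} (hq : 0 ≤ q) (hs₁ : 0 < s₁) (K L b : ℝ) :
    ∀ᶠ R : ℝ in atTop, ∀ s ≥ s₁, ∀ n ≤ Real.exp 1 * s * R + K * s,
      n * (Real.log (16 * Real.exp 2) + 2 * q * Real.log R) + b ≤ radiusFun q L s R := by
  set c₁ := Real.log (15 * Real.exp 3)
  set c₂ := Real.log (16 * Real.exp 2)
  have he : 2 ≤ Real.exp 1 := by linarith [Real.add_one_le_exp (1 : ℝ)]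
  have hc₂ : 0 ≤ c₂ := Real.log_nonneg (by nlinarith [Real.add_one_le_exp (2 : ℝ)])
  have hc : c₂ ≤ c₁ := Real.log_le_log (by positivity) (by
    rw [show (3 : ℝ) = 2 + 1 by norm_num, Real.exp_add]
    nlinarith [Real.exp_pos 2])
  filter_upwards [Real.tendsto_log_atTop.eventually_ge_atTop 1,
    eventually_log_add_le (K * (2 * q)) (K * c₂) one_pos,
    eventually_log_add_le (|L| * (q + 1 / 2)) (|L| * c₁ + b) hs₁, eventually_gt_atTop 0]
    with R hlog hK hL hR s hs n hn
  have hs₀ : 0 < s := hs₁.trans_le hs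
  have hfactor : 0 ≤ radiusFactor q R := by
    have : 0 ≤ (q + 1 / 2) * Real.log R := by positivity
    exact add_nonneg this (hc₂.trans hc)
  have hn' : n * (c₂ + 2 * q * Real.log R) ≤
      (Real.exp 1 * s * R + K * s) * (c₂ + 2 * q * Real.log R) := by gcongr
  have hK' : s * (K * (2 * q) * Real.log R + K * c₂) ≤ s * (1 * R) := by gcongr
  have hL' : -|L| * radiusFactor q R ≤ L * radiusFactor q R := by
    gcongr
    exact neg_abs_le L
  have hs' : s₁ * R ≤ s * R := by gcongr
  have hc' : Real.exp 1 * s * R * c₂ ≤ Real.exp 1 * s * R * (2 * c₁) := by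
    gcongr
    linarith
  have hlog' : 2 * (s * R) * 1 ≤ Real.exp 1 * (s * R) * Real.log R := by gcongr
  simp only [radiusFun, radiusFactor] at hL' ⊢
  linarith

theorem eventually_volume_small_le {q s₁ a : ℝ} (hq : 0 ≤ q) (hs₁ : 0 < s₁) (ha : 0 < a)
    (N x₀ : ℝ) :
    ∀ᶠ R : ℝ in atTop, ∀ s ≥ s₁, ∀ F : ℂ → ℂ, Differentiable ℂ F →
      (∀ z, ‖F z‖ ≤ N * Real.exp (s * |z.im|)) → a ≤ ‖F x₀‖ →
      volume {x : ℝ | |x| ≤ R ∧ ‖F x‖ ≤ Real.exp (-radiusFun q (Real.log N) s R)} ≤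
        ENNReal.ofReal (R ^ (1 - 2 * q)) := by
  set c₀ := Real.log (4 * N / a)
  filter_upwards [eventually_gt_atTop 0, eventually_ge_atTop |x₀|,
    eventually_mul_log_add_le_radiusFun hq hs₁ (Real.exp 1 * |x₀| + (|c₀| + 1) / s₁) (Real.log N)
      (-Real.log (a / 4))] with R hR hx₀ hexponent s hs F hF hN hax
  by_contra! hvol
  have hs₀ : 0 < s := hs₁.trans_le hs
  set n := ⌈s * (Real.exp 1 * (R + |x₀|)) + |c₀|⌉₊
  have hn : s * (Real.exp 1 * (R + |x₀|)) + |c₀| ≤ n := Nat.le_ceil _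
  have hn' : (n : ℝ) ≤ Real.exp 1 * s * R + (Real.exp 1 * |x₀| + (|c₀| + 1) / s₁) * s := by
    have hceil : (n : ℝ) < s * (Real.exp 1 * (R + |x₀|)) + |c₀| + 1 :=
      Nat.ceil_lt_add_one (by positivity)
    have hconst : |c₀| + 1 ≤ (|c₀| + 1) / s₁ * s := by
      rw [div_mul_eq_mul_div, le_div_iff₀ hs₁]
      gcongr
    linarith
  have hcompact : IsCompact
      {x : ℝ | |x| ≤ R ∧ ‖F x‖ ≤ Real.exp (-radiusFun q (Real.log N) s R)} := by
    refine (isCompact_Icc (a := -R) (b := R)).of_isClosed_subset ?_ fun x hx => abs_le.1 hx.1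
    exact (isClosed_le continuous_abs continuous_const).inter
      (isClosed_le (hF.continuous.comp Complex.continuous_ofReal).norm continuous_const)
  have hlower := quarter_lt_of_small_on hF hs₀ hN ha hax hx₀
    (Real.rpow_pos_of_pos hR (1 - 2 * q)) hcompact (fun x hx => hx.1) hvol.le (fun x hx => hx.2)
    ((add_le_add_right (le_abs_self c₀) _).trans hn)
  have hbase : 16 * Real.exp 2 * R / R ^ (1 - 2 * q) =
      Real.exp (Real.log (16 * Real.exp 2) + 2 * q * Real.log R) := by
    rw [Real.exp_add, Real.exp_log (by positivity), mul_comm (2 * q), ← Real.rpow_def_of_pos hR,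
      mul_div_assoc, Real.rpow_sub hR, Real.rpow_one, div_div_cancel₀ hR.ne']
  rw [hbase, ← Real.exp_nat_mul, ← Real.exp_add, ← Real.log_lt_iff_lt_exp (by positivity)]
    at hlower
  linarith [hexponent s hs n hn']

theorem integral_fourier_mul_eq {φ ψ : ℝ → ℂ} (hφ : Integrable φ) (hψ : Integrable ψ) :
    ∫ y, 𝓕 φ y * ψ y = ∫ t, φ t * 𝓕 ψ t := by
  have h := VectorFourier.integral_fourierIntegral_smul_eq_flip (L := innerₗ ℝ)
    Real.continuous_fourierChar continuous_inner hφ hψ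
  rwa [flip_innerₗ] at h

theorem integral_mul_fourier_eq (f : L2) (H : SchwartzMap ℝ ℂ) :
    ∫ y, H y * (𝓕 f : L2) y = ∫ t, 𝓕 H t * f t := by
  have h := congrArg (fun T : TemperedDistribution ℝ ℂ => T H)
    (Lp.fourier_toTemperedDistribution_eq f)
  simp only [TemperedDistribution.fourier_apply, Lp.toTemperedDistribution_apply,
    smul_eq_mul] at h
  exact h.symm

theorem fourierInv_compSubConstCLM (k : SchwartzMap ℝ ℂ) (s y : ℝ) :
    𝓕⁻ (k.compSubConstCLM ℂ (-s)) y = Real.fourierChar (-(y * s)) • 𝓕⁻ k y := by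
  have h := congrFun (VectorFourier.fourierIntegral_comp_add_right Real.fourierChar volume
    (innerₗ ℝ) (k : ℝ → ℂ) s) (-y)
  simp only [SchwartzMap.fourierInv_coe, Real.fourierInv_eq_fourier_neg]
  have hk : (k.compSubConstCLM ℂ (-s) : ℝ → ℂ) = k ∘ fun t => t + s := by
    ext t
    simp
  rw [hk]
  refine h.trans ?_
  simp [Real.fourier_eq, VectorFourier.fourierIntegral]

theorem integral_fourier_mul_translate (f : L2) (H : SchwartzMap ℝ ℂ) (s : ℝ) :
    ∫ t, 𝓕 H t * f (t - s) = 𝓕 (fun y => H y * (𝓕 f : L2) y) s := by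
  have h := integral_mul_fourier_eq f (𝓕⁻ ((𝓕 H).compSubConstCLM ℂ (-s)))
  rw [← integral_add_right_eq_self _ s]
  simp only [FourierTransform.fourier_fourierInv_eq, fourierInv_compSubConstCLM,
    FourierTransform.fourierInv_fourier_eq, SchwartzMap.compSubConstCLM_apply, sub_neg_eq_add] at h
  simp only [add_sub_cancel_right, ← h, Real.fourier_eq, smul_mul_assoc]
  simp [mul_comm s]

theorem integrable_mul_translate {k f φ : ℝ → ℂ} (hk : MemLp k 2) (hf : MemLp f 2)
    (hφ : Integrable φ) :
    Integrable (fun z : ℝ × ℝ => k z.1 * f (z.1 - z.2) * φ z.2) (volume.prod volume) := by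
  have hk_sq : Integrable fun z : ℝ × ℝ => ‖k z.1‖ ^ 2 * ‖φ z.2‖ :=
    (hk.integrable_norm_pow two_ne_zero).mul_prod hφ.norm
  have hf_sq : Integrable fun z : ℝ × ℝ => ‖φ z.2‖ * ‖f (z.1 - z.2)‖ ^ 2 :=
    hφ.norm.convolution_integrand (ContinuousLinearMap.mul ℝ ℝ)
      (hf.integrable_norm_pow two_ne_zero)
  have hmeas : AEStronglyMeasurable (fun z : ℝ × ℝ => k z.1 * f (z.1 - z.2) * φ z.2)
      (volume.prod volume) :=
    (hk.1.comp_fst.mul (hf.1.comp_quasiMeasurePreserving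
      (quasiMeasurePreserving_sub volume volume))).mul hφ.1.comp_snd
  refine (hk_sq.add hf_sq).mono' hmeas (Eventually.of_forall fun z => ?_)
  rw [norm_mul, norm_mul, Pi.add_apply, mul_comm ‖φ z.2‖, ← add_mul]
  gcongr
  nlinarith [sq_nonneg (‖k z.1‖ - ‖f (z.1 - z.2)‖), sq_nonneg (‖k z.1‖ + ‖f (z.1 - z.2)‖)]

theorem integral_mul_fourier_of_isSolution {φ : ℝ → ℂ} (hφ : Integrable φ) {f g : L2}
    (h : IsSolution φ f g) (H : SchwartzMap ℝ ℂ) :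
    ∫ y, H y * (𝓕 g : L2) y = ∫ y, H y * (𝓕 φ y * (𝓕 f : L2) y) := by
  have hk := (𝓕 H : SchwartzMap ℝ ℂ).memLp 2
  have hH : Integrable fun y => H y * (𝓕 f : L2) y :=
    (H.memLp 2 volume).integrable_mul (Lp.memLp (𝓕 f : L2))
  calc ∫ y, H y * (𝓕 g : L2) y
      = ∫ t, 𝓕 H t * g t := integral_mul_fourier_eq g H
    _ = ∫ t, ∫ s, 𝓕 H t * f (t - s) * φ s := by
        refine integral_congr_ae (h.mono fun t ht => ?_)
        simp only [← ht, ← integral_const_mul, mul_assoc]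
    _ = ∫ s, ∫ t, 𝓕 H t * f (t - s) * φ s :=
        integral_integral_swap (integrable_mul_translate hk (Lp.memLp f) hφ)
    _ = ∫ s, φ s * 𝓕 (fun y => H y * (𝓕 f : L2) y) s := by
        simp only [integral_mul_const, integral_fourier_mul_translate, mul_comm (φ _)]
    _ = ∫ y, 𝓕 φ y * (H y * (𝓕 f : L2) y) := (integral_fourier_mul_eq hφ hH).symm
    _ = ∫ y, H y * (𝓕 φ y * (𝓕 f : L2) y) := by simp only [mul_left_comm]

theorem continuous_fourier {φ : ℝ → ℂ} (hφ : Integrable φ) : Continuous (𝓕 φ) :=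
  VectorFourier.fourierIntegral_continuous Real.continuous_fourierChar continuous_inner hφ

theorem fourier_ae_eq_of_isSolution {φ : ℝ → ℂ} (hφ : Integrable φ) {f g : L2}
    (h : IsSolution φ f g) : (𝓕 g : L2) =ᵐ[volume] fun y => 𝓕 φ y * (𝓕 f : L2) y := by
  have hloc (u : L2) : LocallyIntegrable u :=
    (Lp.memLp u).locallyIntegrable (by norm_num)
  refine ae_eq_of_integral_contDiff_smul_eq (hloc _) ?_ fun w hw hc => ?_
  · rw [← locallyIntegrableOn_univ]
    exact (locallyIntegrableOn_univ.2 (hloc (𝓕 f))).continuousOn_mul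
      (continuous_fourier hφ).continuousOn isOpen_univ.isLocallyClosed
  · have hc' : HasCompactSupport (Complex.ofRealCLM ∘ w) := hc.comp_left rfl
    simpa using integral_mul_fourier_of_isSolution hφ h
      (hc'.toSchwartzMap (Complex.ofRealCLM.contDiff.comp hw))

theorem exists_fourier_ne_zero {φ : ℝ → ℂ} (hφ : Integrable φ) (h0 : ¬ φ =ᵐ[volume] 0) :
    ∃ y, 𝓕 φ y ≠ 0 := by
  by_contra! hF
  refine h0 (ae_eq_zero_of_integral_contDiff_smul_eq_zero hφ.locallyIntegrable fun w hw hc => ?_)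
  have hc' : HasCompactSupport (Complex.ofRealCLM ∘ w) := hc.comp_left rfl
  let W : SchwartzMap ℝ ℂ := hc'.toSchwartzMap (Complex.ofRealCLM.contDiff.comp hw)
  have hW (t : ℝ) : 𝓕 ⇑(𝓕⁻ W : SchwartzMap ℝ ℂ) t = w t := by
    rw [← SchwartzMap.fourier_coe, FourierTransform.fourier_fourierInv_eq]
    rfl
  have h := integral_fourier_mul_eq hφ (𝓕⁻ W : SchwartzMap ℝ ℂ).integrable
  simp only [hF, hW, zero_mul, integral_zero] at h
  simpa [mul_comm] using h.symm

theorem hat_eq_fourier (φ : ℝ → ℂ) (x : ℝ) : hat φ x = 𝓕 φ (x / (2 * Real.pi)) := by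
  rw [Real.fourier_real_eq_integral_exp_smul]
  refine integral_congr_ae (Eventually.of_forall fun t => ?_)
  simp only [smul_eq_mul]
  congr 2
  push_cast
  field_simp

theorem norm_hat_le (φ : ℝ → ℂ) (x : ℝ) : ‖hat φ x‖ ≤ norm1 φ := by
  rw [hat_eq_fourier]
  exact VectorFourier.norm_fourierIntegral_le_integral_norm _ _ _ _ _

theorem norm_hat_sub_hat_le {φ ψ : ℝ → ℂ} (hφ : Integrable φ) (hψ : Integrable ψ) (x : ℝ) :
    ‖hat φ x - hat ψ x‖ ≤ norm1 (φ - ψ) := by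
  have h : hat (φ - ψ) x = hat φ x - hat ψ x := by
    simp only [hat_eq_fourier, Real.fourier_eq, Pi.sub_apply, smul_sub]
    exact integral_sub ((Real.fourierIntegral_convergent_iff _).2 hφ)
      ((Real.fourierIntegral_convergent_iff _).2 hψ)
  exact h ▸ norm_hat_le _ _

theorem exists_hat_ne_zero {φ : ℝ → ℂ} (hφ : Integrable φ) (h0 : ¬ φ =ᵐ[volume] 0) :
    ∃ x, hat φ x ≠ 0 := by
  obtain ⟨y, hy⟩ := exists_fourier_ne_zero hφ h0
  refine ⟨2 * Real.pi * y, ?_⟩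
  rwa [hat_eq_fourier, mul_div_cancel_left₀ y Real.two_pi_pos.ne']

theorem map_div_two_pi_volume :
    Measure.map (fun x : ℝ => x / (2 * Real.pi)) volume =
      ENNReal.ofReal (2 * Real.pi) • volume := by
  have h := Real.map_volume_mul_right (inv_ne_zero Real.two_pi_pos.ne')
  rwa [inv_inv, abs_of_pos Real.two_pi_pos] at h

theorem quasiMeasurePreserving_div_two_pi :
    Measure.QuasiMeasurePreserving (fun x : ℝ => x / (2 * Real.pi)) :=
  ⟨measurable_id.div_const _, map_div_two_pi_volume ▸ Measure.smul_absolutelyContinuous⟩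

theorem hat2_ae_eq_of_isSolution {φ : ℝ → ℂ} (hφ : Integrable φ) {f g : L2}
    (h : IsSolution φ f g) : hat2 g =ᵐ[volume] fun x => hat φ x * hat2 f x := by
  simp only [hat_eq_fourier]
  exact quasiMeasurePreserving_div_two_pi.ae_eq_comp (fourier_ae_eq_of_isSolution hφ h)

theorem hat2_sub (f g : L2) : hat2 (f - g) =ᵐ[volume] fun x => hat2 f x - hat2 g x := by
  have h : (𝓕 (f - g) : L2) = 𝓕 f - 𝓕 g := (Lp.fourierTransformₗᵢ ℝ ℂ).map_sub f g
  have h_sub := quasiMeasurePreserving_div_two_pi.ae_eq_comp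
    (Lp.coeFn_sub (𝓕 f : L2) (𝓕 g))
  rwa [← h] at h_sub

theorem aestronglyMeasurable_hat2 (f : L2) : AEStronglyMeasurable (hat2 f) :=
  (Lp.aestronglyMeasurable (𝓕 f : L2)).comp_quasiMeasurePreserving
    quasiMeasurePreserving_div_two_pi

theorem eLpNorm_hat2 (f : L2) :
    eLpNorm (hat2 f) 2 = ENNReal.ofReal (√(2 * Real.pi) * ‖f‖) := by
  have h : eLpNorm (hat2 f) 2 volume =
      eLpNorm (𝓕 f : L2) 2 (ENNReal.ofReal (2 * Real.pi) • volume) := by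
    rw [← map_div_two_pi_volume, eLpNorm_map_measure _ (by fun_prop)]
    · rfl
    · rw [map_div_two_pi_volume]
      exact (Lp.aestronglyMeasurable _).smul_measure _
  rw [h, eLpNorm_smul_measure_of_ne_top (by norm_num), ENNReal.ofReal_mul (Real.sqrt_nonneg _),
    ← Lp.norm_fourier_eq f, Lp.norm_def, ENNReal.ofReal_toReal (Lp.eLpNorm_ne_top _), smul_eq_mul,
    Real.sqrt_eq_rpow, ENNReal.ofReal_rpow_of_pos Real.two_pi_pos]
  norm_num

/-- The Fourier transform of the restriction of `φ` to `[-s, s]`, as an entire function of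
exponential type `s`. -/
noncomputable def truncHat (φ : ℝ → ℂ) (s : ℝ) (z : ℂ) : ℂ :=
  ∫ t in Set.Icc (-s) s, Complex.exp (-(Complex.I * z * t)) * φ t

theorem norm_exp_neg_I_mul (z : ℂ) (t : ℝ) :
    ‖Complex.exp (-(Complex.I * z * t))‖ = Real.exp (t * z.im) := by
  rw [Complex.norm_exp]
  simp [mul_comm]

theorem norm_exp_neg_I_mul_le {s t : ℝ} (ht : |t| ≤ s) (z : ℂ) :
    ‖Complex.exp (-(Complex.I * z * t))‖ ≤ Real.exp (s * |z.im|) := by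
  rw [norm_exp_neg_I_mul, Real.exp_le_exp]
  calc t * z.im ≤ |t| * |z.im| := (le_abs_self _).trans_eq (abs_mul _ _)
    _ ≤ s * |z.im| := by gcongr

theorem norm_truncHat_le {φ : ℝ → ℂ} (hφ : Integrable φ) (s : ℝ) (z : ℂ) :
    ‖truncHat φ s z‖ ≤ norm1 φ * Real.exp (s * |z.im|) := by
  calc ‖truncHat φ s z‖
      ≤ ∫ t in Set.Icc (-s) s, ‖φ t‖ * Real.exp (s * |z.im|) := by
        refine norm_integral_le_of_norm_le (hφ.norm.mul_const _).integrableOn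
          (ae_restrict_of_forall_mem measurableSet_Icc fun t ht => ?_)
        rw [norm_mul, mul_comm]
        gcongr
        exact norm_exp_neg_I_mul_le (abs_le.2 ht) z
    _ = (∫ t in Set.Icc (-s) s, ‖φ t‖) * Real.exp (s * |z.im|) := integral_mul_const _ _
    _ ≤ norm1 φ * Real.exp (s * |z.im|) := by
        gcongr
        exact setIntegral_le_integral hφ.norm (Eventually.of_forall fun _ => norm_nonneg _)

theorem differentiable_truncHat {φ : ℝ → ℂ} (hφ : Integrable φ) (s : ℝ) :
    Differentiable ℂ (truncHat φ s) := by
  intro z₀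
  let μ : Measure ℝ := volume.restrict (Set.Icc (-s) s)
  let F' (z : ℂ) (t : ℝ) : ℂ := Complex.exp (-(Complex.I * z * t)) * -(Complex.I * t) * φ t
  have h_meas (z : ℂ) :
      AEStronglyMeasurable (fun t : ℝ => Complex.exp (-(Complex.I * z * t)) * φ t) μ :=
    (Continuous.aestronglyMeasurable (by fun_prop)).mul hφ.1.restrict
  have h_int : Integrable (fun t : ℝ => Complex.exp (-(Complex.I * z₀ * t)) * φ t) μ := by
    refine hφ.restrict.bdd_mul (c := Real.exp (s * |z₀.im|))
      (Continuous.aestronglyMeasurable (by fun_prop)) ?_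
    exact ae_restrict_of_forall_mem measurableSet_Icc fun t ht =>
      norm_exp_neg_I_mul_le (abs_le.2 ht) z₀
  have h_bound : ∀ᵐ t ∂μ, ∀ z ∈ Metric.ball z₀ 1,
      ‖F' z t‖ ≤ Real.exp (s * (‖z₀‖ + 1)) * s * ‖φ t‖ := by
    refine ae_restrict_of_forall_mem measurableSet_Icc fun t ht z hz => ?_
    have hts : |t| ≤ s := abs_le.2 ht
    have hs : 0 ≤ s := (abs_nonneg t).trans hts
    have hz : |z.im| ≤ ‖z₀‖ + 1 :=
      (Complex.abs_im_le_norm z).trans (norm_lt_of_mem_ball hz).le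
    rw [norm_mul, norm_mul]
    gcongr
    · exact (norm_exp_neg_I_mul_le hts z).trans (by gcongr)
    · simpa using hts
  have h_deriv (t : ℝ) (z : ℂ) :
      HasDerivAt (fun z : ℂ => Complex.exp (-(Complex.I * z * t)) * φ t) (F' z t) z := by
    have h := (((hasDerivAt_id z).const_mul Complex.I).mul_const (t : ℂ)).neg
    rw [mul_one] at h
    exact h.cexp.mul_const (φ t)
  exact (hasDerivAt_integral_of_dominated_loc_of_deriv_le (Metric.ball_mem_nhds z₀ one_pos)
    (Eventually.of_forall h_meas) h_int
    ((Continuous.aestronglyMeasurable (by fun_prop)).mul hφ.1.restrict) h_bound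
    (hφ.norm.const_mul _).restrict
    (Eventually.of_forall fun t z _ => h_deriv t z)).2.differentiableAt

theorem norm_hat_sub_truncHat_le {φ : ℝ → ℂ} (hφ : Integrable φ) (s x : ℝ) :
    ‖hat φ x - truncHat φ s x‖ ≤ ∫ t in (Set.Icc (-s) s)ᶜ, ‖φ t‖ := by
  have h_norm (t : ℝ) : ‖Complex.exp (-(Complex.I * x * t))‖ = 1 := by
    simp [norm_exp_neg_I_mul]
  have h_int : Integrable fun t : ℝ => Complex.exp (-(Complex.I * x * t)) * φ t :=
    hφ.bdd_mul (c := 1) (Continuous.aestronglyMeasurable (by fun_prop))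
      (Eventually.of_forall fun t => (h_norm t).le)
  rw [hat, truncHat, ← integral_add_compl measurableSet_Icc h_int, add_sub_cancel_left]
  refine (norm_integral_le_integral_norm _).trans_eq ?_
  simp only [norm_mul, h_norm, one_mul]

/-- The mass `∫_{|t| ≥ s} |φ(t)| dt`, which is `e^{-p(s)}`, as an extended nonnegative real. -/
noncomputable def tail (φ : ℝ → ℂ) (s : ℝ) : ℝ≥0∞ := ∫⁻ t in {t : ℝ | s ≤ |t|}, ‖φ t‖ₑ

theorem exp_neg_p (φ : ℝ → ℂ) (s : ℝ) : EReal.exp (-p φ s) = tail φ s := by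
  rw [p, neg_neg, ENNReal.exp_log, tail]

theorem tail_anti (φ : ℝ → ℂ) : Antitone (tail φ) := fun _ _ hst =>
  lintegral_mono_set fun _ hx => hst.trans hx

theorem setLIntegral_lt_abs_le {φ : ℝ → ℂ} {c : ℝ} {a : ℝ≥0∞} (h : ∀ s > c, tail φ s ≤ a) :
    ∫⁻ t in {t : ℝ | c < |t|}, ‖φ t‖ₑ ≤ a := by
  obtain ⟨u, hu_anti, hu_gt, hu⟩ := exists_seq_strictAnti_tendsto c
  have h_union : {t : ℝ | c < |t|} = ⋃ n, {t : ℝ | u n ≤ |t|} := by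
    have h := iUnion_Ici_eq_Ioi_of_lt_of_tendsto hu_gt hu
    simpa only [Set.preimage_iUnion] using! (congrArg (Set.preimage (|·|)) h).symm
  have h_mono : Monotone fun n => {t : ℝ | u n ≤ |t|} := fun _ _ hmn _ ht =>
    (hu_anti.antitone hmn).trans ht
  rw [h_union, setLIntegral_iUnion_of_directed _ h_mono.directed_le]
  exact iSup_le fun n => h _ (hu_gt n)

theorem exists_tail_ne_zero {φ : ℝ → ℂ} (hφ : AEStronglyMeasurable φ)
    (h0 : ¬ φ =ᵐ[volume] 0) : ∃ s > 0, tail φ s ≠ 0 := by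
  by_contra! h
  have h_zero : ∫⁻ t in {t : ℝ | 0 < |t|}, ‖φ t‖ₑ = 0 :=
    nonpos_iff_eq_zero.1 (setLIntegral_lt_abs_le fun s hs => (h s hs).le)
  have h_ne : {t : ℝ | 0 < |t|} =ᵐ[volume] Set.univ := by
    simpa only [eventuallyEq_univ, abs_pos] using! Measure.ae_ne volume (0 : ℝ)
  rw [Measure.restrict_congr_set h_ne, Measure.restrict_univ,
    lintegral_eq_zero_iff' hφ.enorm] at h_zero
  exact h0 (h_zero.mono fun t ht => enorm_eq_zero.1 ht)

theorem cutoff_eq (φ : ℝ → ℂ) (ε : ℝ) :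
    cutoff φ ε = sInf {s : ℝ | 0 < s ∧ tail φ s ≤ ENNReal.ofReal ε} := by
  simp only [cutoff, exp_neg_p]

theorem cutoff_nonneg (φ : ℝ → ℂ) (ε : ℝ) : 0 ≤ cutoff φ ε :=
  Real.sInf_nonneg fun _ hs => hs.1.le

theorem cutoff_le {φ : ℝ → ℂ} {ε s : ℝ} (hs : 0 < s) (h : tail φ s ≤ ENNReal.ofReal ε) :
    cutoff φ ε ≤ s := by
  rw [cutoff_eq]
  exact csInf_le ⟨0, fun x hx => hx.1.le⟩ ⟨hs, h⟩

theorem eventually_tail_le_exp {φ : ℝ → ℂ}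
    (hp : Tendsto (fun s : ℝ => p φ s / (s : EReal)) atTop (𝓝 ⊤)) (K : ℝ) :
    ∀ᶠ s : ℝ in atTop, tail φ s ≤ ENNReal.ofReal (Real.exp (-(K * s))) := by
  filter_upwards [hp.eventually (lt_mem_nhds (EReal.coe_lt_top K)), eventually_gt_atTop 0]
    with s hs hs0
  have h : (K : EReal) * s ≤ p φ s :=
    (EReal.le_div_iff_mul_le (by exact_mod_cast hs0) (EReal.coe_ne_top s)).1 hs.le
  rw [← exp_neg_p, ← EReal.exp_coe, EReal.exp_le_exp_iff, EReal.coe_neg, EReal.coe_mul]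
  exact EReal.neg_le_neg_iff.2 h

theorem tail_le_of_cutoff_lt {φ : ℝ → ℂ}
    (hp : Tendsto (fun s : ℝ => p φ s / (s : EReal)) atTop (𝓝 ⊤)) {ε s : ℝ} (hε : 0 < ε)
    (hs : cutoff φ ε < s) : tail φ s ≤ ENNReal.ofReal ε := by
  have h_nonempty : {s : ℝ | 0 < s ∧ tail φ s ≤ ENNReal.ofReal ε}.Nonempty := by
    obtain ⟨s, h_tail, h_log, h_pos⟩ := ((eventually_tail_le_exp hp 1).and
      ((eventually_ge_atTop (-Real.log ε)).and (eventually_gt_atTop 0))).exists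
    refine ⟨s, h_pos, h_tail.trans (ENNReal.ofReal_le_ofReal ?_)⟩
    rw [← Real.le_log_iff_exp_le hε]
    linarith
  rw [cutoff_eq] at hs
  obtain ⟨r, hr, hrs⟩ := exists_lt_of_csInf_lt h_nonempty hs
  exact (tail_anti φ hrs.le).trans hr.2

theorem exists_eventually_le_cutoff {φ : ℝ → ℂ} (hφ : AEStronglyMeasurable φ)
    (h0 : ¬ φ =ᵐ[volume] 0)
    (hp : Tendsto (fun s : ℝ => p φ s / (s : EReal)) atTop (𝓝 ⊤)) :
    ∃ s₁ > 0, ∀ᶠ ε : ℝ in 𝓝[>] 0, s₁ ≤ cutoff φ ε := by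
  obtain ⟨s₁, hs₁, h_tail⟩ := exists_tail_ne_zero hφ h0
  have h_lim : Tendsto ENNReal.ofReal (𝓝[>] 0) (𝓝 0) :=
    (ENNReal.ofReal_zero ▸ ENNReal.continuous_ofReal.tendsto 0).mono_left nhdsWithin_le_nhds
  refine ⟨s₁, hs₁, ?_⟩
  filter_upwards [h_lim.eventually (gt_mem_nhds (pos_iff_ne_zero.2 h_tail)),
    self_mem_nhdsWithin] with ε hε hε0
  exact le_of_not_gt fun h => (tail_le_of_cutoff_lt hp hε0 h).not_gt hε

theorem setIntegral_compl_Icc_cutoff_le {φ : ℝ → ℂ} (hφ : AEStronglyMeasurable φ)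
    (hp : Tendsto (fun s : ℝ => p φ s / (s : EReal)) atTop (𝓝 ⊤)) {ε : ℝ} (hε : 0 < ε) :
    ∫ t in (Set.Icc (-cutoff φ ε) (cutoff φ ε))ᶜ, ‖φ t‖ ≤ ε := by
  have h_compl : (Set.Icc (-cutoff φ ε) (cutoff φ ε))ᶜ = {t : ℝ | cutoff φ ε < |t|} := by
    ext t
    rw [Set.mem_compl_iff, Set.mem_Icc, ← abs_le, not_le, Set.mem_ofPred_eq]
  rw [integral_norm_eq_lintegral_enorm hφ.restrict, h_compl]
  exact ENNReal.toReal_le_of_le_ofReal hε.le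
    (setLIntegral_lt_abs_le fun s hs => tail_le_of_cutoff_lt hp hε hs)

theorem tendsto_log_one_div : Tendsto (fun ε : ℝ => Real.log (1 / ε)) (𝓝[>] 0) atTop := by
  simp only [one_div]
  exact Real.tendsto_log_atTop.comp tendsto_inv_nhdsGT_zero

theorem eventually_cutoff_le_mul_log {φ : ℝ → ℂ}
    (hp : Tendsto (fun s : ℝ => p φ s / (s : EReal)) atTop (𝓝 ⊤)) {c : ℝ} (hc : 0 < c) :
    ∀ᶠ ε : ℝ in 𝓝[>] 0, cutoff φ ε ≤ c * Real.log (1 / ε) := by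
  have h_lim : Tendsto (fun ε : ℝ => c * Real.log (1 / ε)) (𝓝[>] 0) atTop :=
    tendsto_log_one_div.const_mul_atTop hc
  filter_upwards [h_lim.eventually (eventually_tail_le_exp hp c⁻¹), h_lim.eventually_gt_atTop 0,
    self_mem_nhdsWithin] with ε h_tail h_pos hε
  refine cutoff_le h_pos (h_tail.trans_eq ?_)
  rw [inv_mul_cancel_left₀ hc.ne', one_div, Real.log_inv, neg_neg, Real.exp_log hε]

theorem exists_cutoff_le_of_hasCompactSupp {φ : ℝ → ℂ} (h : HasCompactSupp φ) :
    ∃ M : ℝ, ∀ ε : ℝ, cutoff φ ε ≤ M := by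
  obtain ⟨A, hA⟩ := h
  refine ⟨|A| + 1, fun ε => cutoff_le (by positivity) ?_⟩
  have h_zero : tail φ (|A| + 1) = 0 := by
    refine lintegral_eq_zero_of_ae_eq_zero ((ae_restrict_iff' ?_).2 ?_)
    · exact measurableSet_le measurable_const measurable_id.abs
    · filter_upwards [hA] with t ht h_le
      have h_lt : A < |t| := (le_abs_self A).trans_lt ((lt_add_one _).trans_le h_le)
      simp [ht h_lt]
  exact h_zero ▸ zero_le

theorem three_le_radiusFactor {q R : ℝ} (hq : 0 ≤ q) (hR : 1 ≤ R) : 3 ≤ radiusFactor q R := by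
  have h_log : 0 ≤ Real.log R := Real.log_nonneg hR
  have h_const : 3 ≤ Real.log (15 * Real.exp 3) := by
    rw [Real.log_mul (by norm_num) (Real.exp_ne_zero _), Real.log_exp]
    linarith [Real.log_nonneg (show (1 : ℝ) ≤ 15 by norm_num)]
  exact le_add_of_nonneg_of_le (by positivity) h_const

theorem radiusFun_lt_radiusFun {q L s R₁ R₂ : ℝ} (hq : 0 ≤ q) (hs : 0 < s) (h₀ : 0 < R₁)
    (h_lt : R₁ < R₂) (h_factor : 0 < radiusFactor q R₁) (h_pos : 0 < radiusFun q L s R₁) :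
    radiusFun q L s R₁ < radiusFun q L s R₂ := by
  have h_log := Real.log_lt_log h₀ h_lt
  have h_snd := (mul_pos_iff_of_pos_left h_factor).1 h_pos
  refine mul_lt_mul'' ?_ ?_ h_factor.le h_snd.le
  · unfold radiusFactor
    gcongr
  · gcongr

theorem tendsto_radiusFun_atTop {q s : ℝ} (hq : 0 ≤ q) (hs : 0 < s) (L : ℝ) :
    Tendsto (radiusFun q L s) atTop atTop := by
  refine Tendsto.atTop_mul_atTop₀ ?_ ?_
  · exact tendsto_atTop_add_const_right _ _
      (Real.tendsto_log_atTop.const_mul_atTop (by positivity))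
  · exact tendsto_atTop_add_const_left _ _ (tendsto_id.const_mul_atTop (by positivity))

theorem existsUnique_radiusFun_eq {q L s τ : ℝ} (hq : 0 ≤ q) (hs : 0 < s) (hτ : 0 < τ)
    (h_one : radiusFun q L s 1 ≤ τ) :
    ∃! R, 0 < R ∧ 0 < radiusFactor q R ∧ radiusFun q L s R = τ := by
  obtain ⟨T, hT, hτT⟩ := ((eventually_ge_atTop 1).and
    ((tendsto_radiusFun_atTop hq hs L).eventually_ge_atTop τ)).exists
  have h_cont : ContinuousOn (radiusFun q L s) (Set.Icc 1 T) := by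
    have h_log : ContinuousOn Real.log (Set.Icc 1 T) :=
      Real.continuousOn_log.mono fun x hx => (one_pos.trans_le hx.1).ne'
    unfold radiusFun radiusFactor
    fun_prop
  obtain ⟨R, hR, hRτ⟩ := intermediate_value_Icc hT h_cont ⟨h_one, hτT⟩
  refine ⟨R, ⟨one_pos.trans_le hR.1, ?_, hRτ⟩, fun R' ⟨h₀, h_factor, hR'⟩ => ?_⟩
  · linarith [three_le_radiusFactor hq hR.1]
  · rcases lt_trichotomy R' R with h | h | h
    · have := radiusFun_lt_radiusFun hq hs h₀ h h_factor (hR'.symm ▸ hτ)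
      linarith
    · exact h
    · have := radiusFun_lt_radiusFun hq hs (one_pos.trans_le hR.1) h
        (by linarith [three_le_radiusFactor hq hR.1]) (hRτ.symm ▸ hτ)
      linarith

theorem neg_log_rpow_add_le {ε : ℝ} (β : ℝ) (hε : 0 < ε) :
    -Real.log (ε ^ β + ε) ≤ β * Real.log (1 / ε) := by
  have h_log : Real.log (ε ^ β) ≤ Real.log (ε ^ β + ε) :=
    Real.log_le_log (Real.rpow_pos_of_pos hε β) (by linarith)
  rw [Real.log_rpow hε] at h_log
  rw [one_div, Real.log_inv]
  linarith

theorem le_neg_log_rpow_add {ε β : ℝ} (hβ : β ≤ 1) (hε : 0 < ε) (hε₁ : ε ≤ 1) :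
    β * Real.log (1 / ε) - Real.log 2 ≤ -Real.log (ε ^ β + ε) := by
  have h_pos : 0 < ε ^ β := Real.rpow_pos_of_pos hε β
  have h_le : ε ≤ ε ^ β := Real.self_le_rpow_of_le_one hε.le hε₁ hβ
  have h_log : Real.log (ε ^ β + ε) ≤ Real.log (2 * ε ^ β) :=
    Real.log_le_log (by positivity) (by linarith)
  rw [Real.log_mul two_ne_zero h_pos.ne', Real.log_rpow hε] at h_log
  rw [one_div, Real.log_inv]
  linarith

theorem eventually_half_mul_log_add_lt {β : ℝ} (hβ₀ : 0 < β) (hβ₁ : β ≤ 1) (b : ℝ) :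
    ∀ᶠ ε : ℝ in 𝓝[>] 0, β / 2 * Real.log (1 / ε) + b < -Real.log (ε ^ β + ε) := by
  filter_upwards [Ioc_mem_nhdsGT one_pos, (tendsto_log_one_div.const_mul_atTop
    (half_pos hβ₀)).eventually_gt_atTop (b + Real.log 2)] with ε hε h_large
  linarith [le_neg_log_rpow_add hβ₁ hε.1 hε.2]

theorem eventually_radiusFun_lt {φ : ℝ → ℂ} {q β : ℝ} (hq : 0 ≤ q) (hβ₀ : 0 < β) (hβ₁ : β ≤ 1)
    (hp : Tendsto (fun s : ℝ => p φ s / (s : EReal)) atTop (𝓝 ⊤)) (L T : ℝ) :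
    ∀ᶠ ε : ℝ in 𝓝[>] 0, ∀ R : ℝ, 0 < R → R ≤ T → 0 < radiusFactor q R →
      radiusFun q L (cutoff φ ε) R < -Real.log (ε ^ β + ε) := by
  let a := |radiusFactor q T| + 1
  let b := 2 * Real.exp 1 * (|T| + 1)
  have ha : a ≠ 0 := by positivity
  have hb : b ≠ 0 := by positivity
  filter_upwards [eventually_half_mul_log_add_lt hβ₀ hβ₁ (a * |L|),
    eventually_cutoff_le_mul_log hp (c := β / (2 * (a * b))) (by positivity)]
    with ε hτ h_cutoff R hR hRT h_factor
  have hs : 0 ≤ cutoff φ ε := cutoff_nonneg φ ε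
  have h_factor_le : radiusFactor q R ≤ a := by
    have : radiusFactor q R ≤ radiusFactor q T := by
      unfold radiusFactor
      gcongr
    linarith [le_abs_self (radiusFactor q T)]
  have h_snd_le : L + 2 * Real.exp 1 * cutoff φ ε * R ≤ |L| + b * cutoff φ ε := by
    have : 2 * Real.exp 1 * cutoff φ ε * R ≤ 2 * Real.exp 1 * cutoff φ ε * (|T| + 1) := by
      gcongr
      linarith [le_abs_self T]
    linarith [le_abs_self L]
  calc radiusFun q L (cutoff φ ε) R
      ≤ radiusFactor q R * (|L| + b * cutoff φ ε) :=
        mul_le_mul_of_nonneg_left h_snd_le h_factor.le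
    _ ≤ a * (|L| + b * cutoff φ ε) := by gcongr
    _ ≤ a * (|L| + b * (β / (2 * (a * b)) * Real.log (1 / ε))) := by gcongr
    _ = β / 2 * Real.log (1 / ε) + a * |L| := by field_simp; ring
    _ < -Real.log (ε ^ β + ε) := hτ

theorem eventually_existsUnique_isRadius {φ : ℝ → ℂ} {q β : ℝ} (hq : 0 ≤ q) (hβ₀ : 0 < β)
    (hβ₁ : β ≤ 1) (hφ : AEStronglyMeasurable φ) (h0 : ¬ φ =ᵐ[volume] 0)
    (hp : Tendsto (fun s : ℝ => p φ s / (s : EReal)) atTop (𝓝 ⊤)) :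
    ∀ᶠ ε : ℝ in 𝓝[>] 0, ∃! R : ℝ, IsRadius φ q β ε R := by
  obtain ⟨s₁, hs₁, h_cutoff⟩ := exists_eventually_le_cutoff hφ h0 hp
  filter_upwards [eventually_radiusFun_lt hq hβ₀ hβ₁ hp (Real.log (norm1 φ)) 1, h_cutoff,
    eventually_half_mul_log_add_lt hβ₀ hβ₁ 0, tendsto_log_one_div.eventually_gt_atTop 0]
    with ε h_one hs hτ h_log
  have h_factor : 0 < radiusFactor q 1 := by linarith [three_le_radiusFactor hq le_rfl]
  exact existsUnique_radiusFun_eq hq (hs₁.trans_le hs) (lt_trans (by positivity) hτ)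
    (h_one 1 one_pos le_rfl h_factor).le

theorem tendsto_radius {φ : ℝ → ℂ} {q β : ℝ} (hq : 0 ≤ q) (hβ₀ : 0 < β) (hβ₁ : β ≤ 1)
    (hp : Tendsto (fun s : ℝ => p φ s / (s : EReal)) atTop (𝓝 ⊤)) {R : ℝ → ℝ}
    (hR : ∀ᶠ ε : ℝ in 𝓝[>] 0, IsRadius φ q β ε (R ε)) :
    Tendsto R (𝓝[>] 0) atTop := by
  refine tendsto_atTop.2 fun T => ?_
  filter_upwards [hR, eventually_radiusFun_lt hq hβ₀ hβ₁ hp (Real.log (norm1 φ)) T]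
    with ε ⟨h_pos, h_factor, h_eq⟩ h_lt
  exact le_of_not_ge fun h => (h_lt (R ε) h_pos h h_factor).ne h_eq

theorem exists_radius_le_mul_log {φ : ℝ → ℂ} {q β : ℝ} (hq : 0 ≤ q) (hβ₀ : 0 < β)
    (hβ₁ : β ≤ 1) (hφ : AEStronglyMeasurable φ) (h0 : ¬ φ =ᵐ[volume] 0)
    (hp : Tendsto (fun s : ℝ => p φ s / (s : EReal)) atTop (𝓝 ⊤)) {R : ℝ → ℝ}
    (hR : ∀ᶠ ε : ℝ in 𝓝[>] 0, IsRadius φ q β ε (R ε)) :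
    ∃ K > 0, ∀ᶠ ε : ℝ in 𝓝[>] 0, R ε ≤ K * Real.log (1 / ε) := by
  obtain ⟨s₁, hs₁, h_cutoff⟩ := exists_eventually_le_cutoff hφ h0 hp
  have h_top := tendsto_radius hq hβ₀ hβ₁ hp hR
  have h_large := (h_top.const_mul_atTop
    (show 0 < Real.exp 1 * s₁ by positivity)).eventually_ge_atTop (-Real.log (norm1 φ))
  refine ⟨β / (Real.exp 1 * s₁), by positivity, ?_⟩
  filter_upwards [hR, h_cutoff, self_mem_nhdsWithin, h_top.eventually_ge_atTop 1, h_large]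
    with ε ⟨h_pos, _, h_eq⟩ hs hε h_one h_large
  have h_factor : 1 ≤ radiusFactor q (R ε) := by linarith [three_le_radiusFactor hq h_one]
  have h_snd : Real.exp 1 * s₁ * R ε ≤
      Real.log (norm1 φ) + 2 * Real.exp 1 * cutoff φ ε * R ε := by
    have : 2 * Real.exp 1 * s₁ * R ε ≤ 2 * Real.exp 1 * cutoff φ ε * R ε := by gcongr
    linarith
  rw [div_mul_eq_mul_div, le_div_iff₀' (by positivity)]
  calc Real.exp 1 * s₁ * R ε
      ≤ Real.log (norm1 φ) + 2 * Real.exp 1 * cutoff φ ε * R ε := h_snd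
    _ ≤ radiusFun q (Real.log (norm1 φ)) (cutoff φ ε) (R ε) :=
        le_mul_of_one_le_left (le_trans (by positivity) h_snd) h_factor
    _ = -Real.log (ε ^ β + ε) := h_eq
    _ ≤ β * Real.log (1 / ε) := neg_log_rpow_add_le β hε

theorem eventually_radiusFun_le_rpow {q η : ℝ} (hq : 0 ≤ q) (hη : 0 < η) (L M : ℝ) :
    ∀ᶠ R in atTop, ∀ s ≤ M, radiusFun q L s R ≤ R ^ (1 + η) := by
  let D := |L| + 2 * Real.exp 1 * |M|
  filter_upwards [(tendsto_rpow_atTop hη).eventually (eventually_log_add_le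
    (D * (q + 1 / 2) / η) (D * Real.log (15 * Real.exp 3)) one_pos), eventually_ge_atTop 1]
    with R h_log hR s hs
  have hR₀ : 0 < R := one_pos.trans_le hR
  have h_factor : 0 ≤ radiusFactor q R := by linarith [three_le_radiusFactor hq hR]
  have h_snd : L + 2 * Real.exp 1 * s * R ≤ D * R := by
    have hsR : 2 * Real.exp 1 * s * R ≤ 2 * Real.exp 1 * |M| * R := by
      gcongr
      exact hs.trans (le_abs_self M)
    linarith [le_abs_self L, le_mul_of_one_le_right (abs_nonneg L) hR]
  have h_power : D * radiusFactor q R ≤ R ^ η := by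
    rw [Real.log_rpow hR₀, one_mul] at h_log
    refine le_trans (le_of_eq ?_) h_log
    unfold radiusFactor
    field_simp
  calc radiusFun q L s R ≤ radiusFactor q R * (D * R) := mul_le_mul_of_nonneg_left h_snd h_factor
    _ = D * radiusFactor q R * R := by ring
    _ ≤ R ^ η * R := by gcongr
    _ = R ^ (1 + η) := by rw [add_comm, Real.rpow_add_one hR₀.ne']

theorem tendsto_log_div_log {ι : Type*} {F : Filter ι} {R l : ι → ℝ} {K b : ℝ} (hK : 0 < K)
    (hb : 0 < b) (hl : Tendsto l F atTop) (hR : ∀ᶠ i in F, 0 < R i)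
    (h_le : ∀ᶠ i in F, R i ≤ K * l i) (h_ge : ∀ η : ℝ, 0 < η → ∀ᶠ i in F, b * l i ≤ R i ^ (1 + η)) :
    Tendsto (fun i => Real.log (R i) / Real.log (l i)) F (𝓝 1) := by
  have h_log : Tendsto (fun i => Real.log (l i)) F atTop := Real.tendsto_log_atTop.comp hl
  refine Metric.tendsto_nhds.2 fun δ hδ => ?_
  obtain ⟨η, hη, hηδ⟩ := exists_between hδ
  filter_upwards [hR, h_le, h_ge η hη, hl.eventually_gt_atTop 0, h_log.eventually_gt_atTop 0,
    (h_log.const_mul_atTop hη).eventually_ge_atTop (Real.log K),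
    (h_log.const_mul_atTop (mul_pos hη hη)).eventually_ge_atTop (-Real.log b)]
    with i hR h_le h_ge hl h_log hK_log hb_log
  have h_upper : Real.log (R i) ≤ (1 + η) * Real.log (l i) := by
    have := Real.log_le_log hR h_le
    rw [Real.log_mul hK.ne' hl.ne'] at this
    linarith
  have h_lower : (1 - η) * Real.log (l i) ≤ Real.log (R i) := by
    have := Real.log_le_log (by positivity) h_ge
    rw [Real.log_mul hb.ne' hl.ne', Real.log_rpow hR] at this
    refine le_of_mul_le_mul_left (a := 1 + η) ?_ (by positivity)
    linarith
  rw [Real.dist_eq, abs_lt, lt_sub_iff_add_lt, sub_lt_iff_lt_add, lt_div_iff₀ h_log,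
    div_lt_iff₀ h_log]
  constructor <;> nlinarith

theorem tendsto_log_radius_div {φ : ℝ → ℂ} {q β M : ℝ} (hq : 0 ≤ q) (hβ₀ : 0 < β)
    (hβ₁ : β ≤ 1) (hφ : AEStronglyMeasurable φ) (h0 : ¬ φ =ᵐ[volume] 0)
    (hp : Tendsto (fun s : ℝ => p φ s / (s : EReal)) atTop (𝓝 ⊤)) (hM : ∀ ε, cutoff φ ε ≤ M)
    {R : ℝ → ℝ} (hR : ∀ᶠ ε : ℝ in 𝓝[>] 0, IsRadius φ q β ε (R ε)) :
    Tendsto (fun ε : ℝ => Real.log (R ε) / Real.log (Real.log (1 / ε))) (𝓝[>] 0) (𝓝 1) := by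
  obtain ⟨K, hK, h_le⟩ := exists_radius_le_mul_log hq hβ₀ hβ₁ hφ h0 hp hR
  refine tendsto_log_div_log hK (half_pos hβ₀) tendsto_log_one_div (hR.mono fun _ h => h.1) h_le
    fun η hη => ?_
  filter_upwards [hR, eventually_half_mul_log_add_lt hβ₀ hβ₁ 0,
    (tendsto_radius hq hβ₀ hβ₁ hp hR).eventually
      (eventually_radiusFun_le_rpow hq hη (Real.log (norm1 φ)) M)] with ε ⟨_, _, h_eq⟩ hτ h_power
  calc β / 2 * Real.log (1 / ε) ≤ -Real.log (ε ^ β + ε) := by linarith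
    _ = radiusFun q (Real.log (norm1 φ)) (cutoff φ ε) (R ε) := h_eq.symm
    _ ≤ R ε ^ (1 + η) := h_power _ (hM ε)

theorem lintegral_Ioi_rpow {a R : ℝ} (ha : a < -1) (hR : 0 < R) :
    ∫⁻ x in Set.Ioi R, ENNReal.ofReal (x ^ a) = ENNReal.ofReal (-R ^ (a + 1) / (a + 1)) := by
  rw [← integral_Ioi_rpow_of_lt ha hR]
  refine (ofReal_integral_eq_lintegral_ofReal (integrableOn_Ioi_rpow_of_lt ha hR) ?_).symm
  filter_upwards [ae_restrict_mem measurableSet_Ioi] with x hx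
  exact Real.rpow_nonneg (hR.trans hx).le a

theorem lintegral_lt_abs_le_two_mul_lintegral_Ioi (h : ℝ → ℝ≥0∞) (R : ℝ) :
    ∫⁻ x in {x : ℝ | R < |x|}, h |x| ≤ 2 * ∫⁻ x in Set.Ioi R, h |x| := by
  have h_set : {x : ℝ | R < |x|} = Set.Ioi R ∪ Set.Iio (-R) := by
    ext x
    simp only [Set.mem_ofPred_eq, Set.mem_union, Set.mem_Ioi, Set.mem_Iio, lt_abs, lt_neg]
  have h_neg : ∫⁻ x in Set.Iio (-R), h |x| = ∫⁻ x in Set.Ioi R, h |x| := by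
    rw [← lintegral_indicator measurableSet_Iio, ← lintegral_indicator measurableSet_Ioi,
      ← lintegral_neg_eq_self]
    simp only [Set.indicator_apply, Set.mem_Iio, Set.mem_Ioi, neg_lt_neg_iff, abs_neg]
  rw [h_set, two_mul]
  exact (lintegral_union_le _ _ _).trans (add_le_add_right h_neg.le _)

theorem lintegral_lt_abs_rpow_le {a R : ℝ} (ha : a < -1) (hR : 0 < R) :
    ∫⁻ x in {x : ℝ | R < |x|}, ENNReal.ofReal (|x| ^ a) ≤
      ENNReal.ofReal (2 * (-R ^ (a + 1) / (a + 1))) := by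
  refine (lintegral_lt_abs_le_two_mul_lintegral_Ioi (fun t => ENNReal.ofReal (t ^ a)) R).trans ?_
  rw [ENNReal.ofReal_mul zero_le_two, ENNReal.ofReal_ofNat, ← lintegral_Ioi_rpow ha hR]
  gcongr 2 * ?_
  refine (setLIntegral_congr_fun measurableSet_Ioi fun x hx => ?_).le
  simp only [abs_of_pos (hR.trans hx)]

section Decay

variable {u : ℝ → ℂ} {C q : ℝ}

theorem setLIntegral_lt_abs_norm_sq_le {R : ℝ} (hq : 1 / 2 < q) (hR : 0 < R) (hC : 0 ≤ C)
    (hu : ∀ᵐ x : ℝ, ‖u x‖ ^ 2 ≤ C * (1 + x ^ 2) ^ (-q)) :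
    ∫⁻ x in {x : ℝ | R < |x|}, ENNReal.ofReal (‖u x‖ ^ 2) ≤
      ENNReal.ofReal (C * (2 / (2 * q - 1)) * R ^ (1 - 2 * q)) := by
  have h_abs : ∀ x : ℝ, R < |x| → (1 + x ^ 2) ^ (-q) ≤ |x| ^ (-(2 * q)) := fun x hx => by
    have h₀ : 0 < |x| := hR.trans hx
    rw [← mul_neg, Real.rpow_mul h₀.le, Real.rpow_two, sq_abs]
    refine Real.rpow_le_rpow_of_nonpos ?_ (by linarith) (by linarith)
    exact sq_pos_of_pos h₀ |>.trans_eq (sq_abs x)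
  calc ∫⁻ x in {x : ℝ | R < |x|}, ENNReal.ofReal (‖u x‖ ^ 2)
      ≤ ∫⁻ x in {x : ℝ | R < |x|}, ENNReal.ofReal C * ENNReal.ofReal (|x| ^ (-(2 * q))) := by
        refine setLIntegral_mono_ae' (measurableSet_lt measurable_const measurable_id.abs) ?_
        filter_upwards [hu] with x hux hx
        rw [← ENNReal.ofReal_mul hC]
        gcongr
        exact hux.trans (mul_le_mul_of_nonneg_left (h_abs x hx) hC)
    _ = ENNReal.ofReal C * ∫⁻ x in {x : ℝ | R < |x|}, ENNReal.ofReal (|x| ^ (-(2 * q))) :=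
        lintegral_const_mul _ (by fun_prop)
    _ ≤ ENNReal.ofReal C * ENNReal.ofReal (2 * (-R ^ (-(2 * q) + 1) / (-(2 * q) + 1))) := by
        gcongr
        exact lintegral_lt_abs_rpow_le (by linarith) hR
    _ = ENNReal.ofReal (C * (2 / (2 * q - 1)) * R ^ (1 - 2 * q)) := by
        rw [← ENNReal.ofReal_mul hC, neg_add_eq_sub, ← neg_sub (2 * q) 1, neg_div_neg_eq]
        ring_nf

theorem setLIntegral_norm_sq_le (hq : 0 ≤ q) (hC : 0 ≤ C)
    (hu : ∀ᵐ x : ℝ, ‖u x‖ ^ 2 ≤ C * (1 + x ^ 2) ^ (-q)) (E : Set ℝ) :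
    ∫⁻ x in E, ENNReal.ofReal (‖u x‖ ^ 2) ≤ ENNReal.ofReal C * volume E := by
  rw [← setLIntegral_const]
  refine lintegral_mono_ae (ae_restrict_of_ae ?_)
  filter_upwards [hu] with x hx
  refine ENNReal.ofReal_le_ofReal (hx.trans (mul_le_of_le_one_right hC ?_))
  exact Real.rpow_le_one_of_one_le_of_nonpos (by linarith [sq_nonneg x]) (by linarith)

theorem eLpNorm_two_le_of_lintegral_le {α E : Type*} [MeasurableSpace α] [NormedAddCommGroup E]
    {μ : Measure α} {h : α → E} {A : ℝ} (hA : 0 ≤ A)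
    (h_le : ∫⁻ x, ENNReal.ofReal (‖h x‖ ^ 2) ∂μ ≤ ENNReal.ofReal A) :
    eLpNorm h 2 μ ≤ ENNReal.ofReal (√A) := by
  rw [eLpNorm_eq_lintegral_rpow_enorm_toReal two_ne_zero ENNReal.ofNat_ne_top,
    ENNReal.toReal_ofNat, Real.sqrt_eq_rpow, ← ENNReal.ofReal_rpow_of_nonneg hA (by norm_num)]
  refine ENNReal.rpow_le_rpow (le_of_eq_of_le (lintegral_congr fun x => ?_) h_le) (by norm_num)
  rw [ENNReal.rpow_two, ENNReal.ofReal_pow (norm_nonneg _), ofReal_norm]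

theorem eLpNorm_indicator_le {R : ℝ} (hq : 1 / 2 < q) (hR : 0 < R) (hC : 0 ≤ C)
    (hu : ∀ᵐ x : ℝ, ‖u x‖ ^ 2 ≤ C * (1 + x ^ 2) ^ (-q)) {E : Set ℝ} (hE : MeasurableSet E)
    (hvol : volume E ≤ ENNReal.ofReal (R ^ (1 - 2 * q))) :
    eLpNorm (({x : ℝ | R < |x|} ∪ E).indicator u) 2 ≤
      ENNReal.ofReal (√(C * (2 / (2 * q - 1) + 1)) * R ^ (-q + 1 / 2)) := by
  have hq₁ : 0 < 2 * q - 1 := by linarith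
  have h_sqrt : √(R ^ (1 - 2 * q)) = R ^ (-q + 1 / 2) := by
    rw [Real.sqrt_eq_rpow, ← Real.rpow_mul hR.le]
    ring_nf
  have h_meas : MeasurableSet ({x : ℝ | R < |x|} ∪ E) :=
    (measurableSet_lt measurable_const measurable_id.abs).union hE
  rw [eLpNorm_indicator_eq_eLpNorm_restrict h_meas, ← h_sqrt, ← Real.sqrt_mul (by positivity)]
  refine eLpNorm_two_le_of_lintegral_le (by positivity) ?_
  calc ∫⁻ x in {x : ℝ | R < |x|} ∪ E, ENNReal.ofReal (‖u x‖ ^ 2)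
      ≤ ENNReal.ofReal (C * (2 / (2 * q - 1)) * R ^ (1 - 2 * q)) +
          ENNReal.ofReal C * volume E :=
        (lintegral_union_le _ _ _).trans (add_le_add
          (setLIntegral_lt_abs_norm_sq_le hq hR hC hu)
          (setLIntegral_norm_sq_le (by linarith) hC hu E))
    _ ≤ ENNReal.ofReal (C * (2 / (2 * q - 1)) * R ^ (1 - 2 * q)) +
          ENNReal.ofReal C * ENNReal.ofReal (R ^ (1 - 2 * q)) := by gcongr
    _ = ENNReal.ofReal (C * (2 / (2 * q - 1) + 1) * R ^ (1 - 2 * q)) := by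
        rw [← ENNReal.ofReal_mul hC, ← ENNReal.ofReal_add (by positivity) (by positivity)]
        ring_nf

end Decay

theorem eLpNorm_le_of_norm_le_add {α E : Type*} [MeasurableSpace α] [NormedAddCommGroup E]
    {μ : Measure α} {r : ℝ≥0∞} (hr : 1 ≤ r) {F A B D : α → E} {κ₁ κ₂ : ℝ}
    (hA : AEStronglyMeasurable A μ) (hB : AEStronglyMeasurable B μ)
    (hD : AEStronglyMeasurable D μ) (h : ∀ᵐ x ∂μ, ‖F x‖ ≤ ‖A x‖ + κ₁ * ‖B x‖ + κ₂ * ‖D x‖) :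
    eLpNorm F r μ ≤ eLpNorm A r μ + ‖κ₁‖ₑ * eLpNorm B r μ + ‖κ₂‖ₑ * eLpNorm D r μ := by
  have h_scale : ∀ (κ : ℝ) (W : α → E),
      eLpNorm (fun x => κ * ‖W x‖) r μ = ‖κ‖ₑ * eLpNorm W r μ := fun κ W => by
    rw [← eLpNorm_norm W]
    exact eLpNorm_const_smul κ (fun x => ‖W x‖) r μ
  have hB' : AEStronglyMeasurable (fun x => κ₁ * ‖B x‖) μ := hB.norm.const_mul _
  have hD' : AEStronglyMeasurable (fun x => κ₂ * ‖D x‖) μ := hD.norm.const_mul _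
  calc eLpNorm F r μ
      ≤ eLpNorm ((fun x => ‖A x‖) + (fun x => κ₁ * ‖B x‖) + fun x => κ₂ * ‖D x‖) r μ :=
        eLpNorm_mono_ae_real h
    _ ≤ eLpNorm (fun x => ‖A x‖) r μ + eLpNorm (fun x => κ₁ * ‖B x‖) r μ +
          eLpNorm (fun x => κ₂ * ‖D x‖) r μ :=
        (eLpNorm_add_le (hA.norm.add hB') hD' hr).trans
          (add_le_add_left (eLpNorm_add_le hA.norm hB' hr) _)
    _ = eLpNorm A r μ + ‖κ₁‖ₑ * eLpNorm B r μ + ‖κ₂‖ₑ * eLpNorm D r μ := by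
        rw [eLpNorm_norm, h_scale, h_scale]

theorem le_add_sq_div_two_mul_sqrt {δ : ℝ} (hδ : 0 < δ) (b : ℝ) :
    b ≤ (δ + b ^ 2) / (2 * √δ) := by
  rw [le_div_iff₀ (by positivity)]
  linarith [sq_nonneg (√δ - b), sub_sq (√δ) b, Real.sq_sqrt hδ.le]

theorem norm_sub_tikhonov_le {a b u w : ℂ} {δ ε : ℝ} (hδ : 0 < δ) (hab : ‖a - b‖ ≤ ε) :
    ‖u - w * (starRingEnd ℂ) b / ((δ + ‖b‖ ^ 2 : ℝ) : ℂ)‖ ≤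
      δ / (δ + ‖b‖ ^ 2) * ‖u‖ + (ε * ‖u‖ + ‖w - a * u‖) / (2 * √δ) := by
  have h_den : 0 < δ + ‖b‖ ^ 2 := by positivity
  have h_ne : ((δ + ‖b‖ ^ 2 : ℝ) : ℂ) ≠ 0 := by exact_mod_cast h_den.ne'
  have h_decomp : u - w * (starRingEnd ℂ) b / ((δ + ‖b‖ ^ 2 : ℝ) : ℂ) =
      (δ * u - ((a - b) * u + (w - a * u)) * (starRingEnd ℂ) b) /
        ((δ + ‖b‖ ^ 2 : ℝ) : ℂ) := by
    rw [eq_div_iff h_ne, sub_mul, div_mul_cancel₀ _ h_ne, Complex.ofReal_add, Complex.ofReal_pow,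
      ← Complex.mul_conj']
    ring
  have h_num : ‖δ * u - ((a - b) * u + (w - a * u)) * (starRingEnd ℂ) b‖ ≤
      δ * ‖u‖ + (ε * ‖u‖ + ‖w - a * u‖) * ‖b‖ := by
    refine (norm_sub_le _ _).trans ?_
    rw [norm_mul, norm_mul, RCLike.norm_conj, Complex.norm_real, Real.norm_of_nonneg hδ.le]
    gcongr
    refine (norm_add_le _ _).trans ?_
    rw [norm_mul]
    gcongr
  have hε : 0 ≤ ε := (norm_nonneg _).trans hab
  rw [h_decomp, norm_div, Complex.norm_real, Real.norm_of_nonneg h_den.le, div_le_iff₀ h_den]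
  calc ‖δ * u - ((a - b) * u + (w - a * u)) * (starRingEnd ℂ) b‖
      ≤ δ * ‖u‖ + (ε * ‖u‖ + ‖w - a * u‖) * ((δ + ‖b‖ ^ 2) / (2 * √δ)) := by
        refine h_num.trans ?_
        gcongr
        exact le_add_sq_div_two_mul_sqrt hδ ‖b‖
    _ = (δ / (δ + ‖b‖ ^ 2) * ‖u‖ + (ε * ‖u‖ + ‖w - a * u‖) / (2 * √δ)) * (δ + ‖b‖ ^ 2) := by
        field_simp

theorem div_add_sq_mul_norm_le {α E : Type*} [NormedAddCommGroup E] {S : Set α} {u : α → E}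
    {x : α} {δ b m : ℝ} (hδ : 0 < δ) (hm : 0 < m) (hb : x ∉ S → m ≤ b) :
    δ / (δ + b ^ 2) * ‖u x‖ ≤ ‖S.indicator u x‖ + δ / m ^ 2 * ‖u x‖ := by
  by_cases hx : x ∈ S
  · rw [Set.indicator_of_mem hx]
    have h_one : δ / (δ + b ^ 2) ≤ 1 :=
      (div_le_one (by positivity)).2 (by linarith [sq_nonneg b])
    exact (mul_le_of_le_one_left (norm_nonneg _) h_one).trans
      (le_add_of_nonneg_right (by positivity))
  · rw [Set.indicator_of_notMem hx, norm_zero, zero_add]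
    have h_sq : m ^ 2 ≤ δ + b ^ 2 := by linarith [pow_le_pow_left₀ hm.le (hb hx) 2]
    gcongr

theorem ae_norm_hat2_sub_le_of_isTikhonov {φ₀ φ : ℝ → ℂ} (hφ₀ : Integrable φ₀)
    (hφ : Integrable φ) {f₀ g₀ f g : L2} {S : Set ℝ} {δ ε m : ℝ} (hδ : 0 < δ) (hm : 0 < m)
    (hsol : IsSolution φ₀ f₀ g₀) (h_large : ∀ x ∉ S, m ≤ ‖hat φ x‖)
    (hφε : norm1 (φ₀ - φ) ≤ ε) (hf : IsTikhonov δ φ g f) :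
    ∀ᵐ x : ℝ, ‖hat2 (f₀ - f) x‖ ≤ ‖S.indicator (hat2 f₀) x‖ +
      (δ / m ^ 2 + ε / (2 * √δ)) * ‖hat2 f₀ x‖ + 1 / (2 * √δ) * ‖hat2 (g - g₀) x‖ := by
  filter_upwards [hat2_sub f₀ f, hat2_sub g g₀, hf, hat2_ae_eq_of_isSolution hφ₀ hsol]
    with x hx_f hx_g hx_tikhonov hx_sol
  have h_hat : ‖hat φ₀ x - hat φ x‖ ≤ ε := (norm_hat_sub_hat_le hφ₀ hφ x).trans hφε
  rw [hx_f, hx_g, hx_tikhonov, hx_sol]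
  calc _ ≤ δ / (δ + ‖hat φ x‖ ^ 2) * ‖hat2 f₀ x‖ +
          (ε * ‖hat2 f₀ x‖ + ‖hat2 g x - hat φ₀ x * hat2 f₀ x‖) / (2 * √δ) :=
        norm_sub_tikhonov_le hδ h_hat
    _ ≤ ‖S.indicator (hat2 f₀) x‖ + δ / m ^ 2 * ‖hat2 f₀ x‖ +
          (ε * ‖hat2 f₀ x‖ + ‖hat2 g x - hat φ₀ x * hat2 f₀ x‖) / (2 * √δ) := by
        gcongr
        exact div_add_sq_mul_norm_le hδ hm (h_large x)
    _ = _ := by ring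

theorem norm_le_of_norm_hat2_le {f u v : L2} {A : ℝ → ℂ} {r κ₁ κ₂ : ℝ}
    (hA : AEStronglyMeasurable A) (hr : 0 ≤ r) (hκ₁ : 0 ≤ κ₁) (hκ₂ : 0 ≤ κ₂)
    (hAr : eLpNorm A 2 ≤ ENNReal.ofReal r)
    (h : ∀ᵐ x : ℝ, ‖hat2 f x‖ ≤ ‖A x‖ + κ₁ * ‖hat2 u x‖ + κ₂ * ‖hat2 v x‖) :
    ‖f‖ ≤ r + κ₁ * ‖u‖ + κ₂ * ‖v‖ := by
  have h_pi : 1 ≤ √(2 * Real.pi) := Real.one_le_sqrt.2 (by linarith [Real.pi_gt_three])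
  have h_norm : √(2 * Real.pi) * ‖f‖ ≤
      r + κ₁ * (√(2 * Real.pi) * ‖u‖) + κ₂ * (√(2 * Real.pi) * ‖v‖) := by
    have h_eLpNorm := eLpNorm_le_of_norm_le_add one_le_two hA (aestronglyMeasurable_hat2 u)
      (aestronglyMeasurable_hat2 v) h
    simp only [eLpNorm_hat2] at h_eLpNorm
    refine (ENNReal.ofReal_le_ofReal_iff (by positivity)).1 (h_eLpNorm.trans ?_)
    rw [ENNReal.ofReal_add (by positivity) (by positivity),
      ENNReal.ofReal_add hr (by positivity), ENNReal.ofReal_mul hκ₁, ENNReal.ofReal_mul hκ₂,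
      Real.enorm_of_nonneg hκ₁, Real.enorm_of_nonneg hκ₂]
    gcongr
  refine le_of_mul_le_mul_left (h_norm.trans ?_) (one_pos.trans_le h_pi)
  linarith [le_mul_of_one_le_left hr h_pi]

theorem norm_sub_le_of_isTikhonov {φ₀ φ : ℝ → ℂ} (hφ₀ : Integrable φ₀) (hφ : Integrable φ)
    {f₀ g₀ f g : L2} {S : Set ℝ} {δ ε m r : ℝ} (hδ : 0 < δ) (hm : 0 < m) (hr : 0 ≤ r)
    (hsol : IsSolution φ₀ f₀ g₀) (hS : MeasurableSet S)
    (h_ind : eLpNorm (S.indicator (hat2 f₀)) 2 ≤ ENNReal.ofReal r)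
    (h_large : ∀ x ∉ S, m ≤ ‖hat φ x‖) (hφε : norm1 (φ₀ - φ) ≤ ε) (hgε : ‖g₀ - g‖ ≤ ε)
    (hf : IsTikhonov δ φ g f) :
    ‖f₀ - f‖ ≤ r + (δ / m ^ 2 + ε / (2 * √δ)) * ‖f₀‖ + ε / (2 * √δ) := by
  have hε : 0 ≤ ε := (norm_nonneg _).trans hgε
  have h_ind_meas := (aestronglyMeasurable_hat2 f₀).indicator hS
  refine (norm_le_of_norm_hat2_le h_ind_meas hr (by positivity) (by positivity) h_ind
    (ae_norm_hat2_sub_le_of_isTikhonov hφ₀ hφ hδ hm hsol h_large hφε hf)).trans ?_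
  rw [norm_sub_rev g, ← one_div_mul_eq_div _ ε]
  gcongr

theorem eventually_two_mul_le_rpow {β : ℝ} (hβ : β < 1) :
    ∀ᶠ ε : ℝ in 𝓝[>] 0, 2 * ε ≤ ε ^ β := by
  have h_lim : Tendsto (fun ε : ℝ => ε ^ (1 - β)) (𝓝[>] 0) (𝓝 0) := by
    have h := (Real.continuousAt_rpow_const 0 (1 - β) (Or.inr (by linarith))).tendsto
    rw [Real.zero_rpow (by linarith)] at h
    exact h.mono_left nhdsWithin_le_nhds
  filter_upwards [h_lim.eventually_le_const (show (0 : ℝ) < 1 / 2 by norm_num),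
    self_mem_nhdsWithin] with ε h_half (hε : 0 < ε)
  calc 2 * ε = 2 * (ε ^ (1 - β) * ε ^ β) := by
        rw [← Real.rpow_add hε, sub_add_cancel, Real.rpow_one]
    _ ≤ 2 * (1 / 2 * ε ^ β) := by gcongr
    _ = ε ^ β := by ring

theorem mul_rpow_div_sq (D β : ℝ) {ε : ℝ} (hε : 0 < ε) :
    D * ε ^ ((1 + 3 * β) / 2) / (ε ^ β / 2) ^ 2 = 4 * D * ε ^ ((1 - β) / 2) := by
  have h_split : ε ^ ((1 + 3 * β) / 2) = ε ^ ((1 - β) / 2) * (ε ^ β) ^ 2 := by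
    rw [← Real.rpow_two, ← Real.rpow_mul hε.le, ← Real.rpow_add hε]
    ring_nf
  have : 0 < ε ^ β := Real.rpow_pos_of_pos hε β
  rw [h_split]
  field_simp
  ring

theorem div_two_mul_sqrt_mul_rpow {D ε : ℝ} (hD : 0 ≤ D) (β : ℝ) (hε : 0 < ε) :
    ε / (2 * √(D * ε ^ ((1 + 3 * β) / 2))) = (2 * √D)⁻¹ * ε ^ (3 * (1 - β) / 4) := by
  have h_sqrt : √(ε ^ ((1 + 3 * β) / 2)) = ε ^ ((1 + 3 * β) / 4) := by
    rw [Real.sqrt_eq_rpow, ← Real.rpow_mul hε.le]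
    ring_nf
  have h_quot : ε / ε ^ ((1 + 3 * β) / 4) = ε ^ (3 * (1 - β) / 4) := by
    have h_sub := Real.rpow_sub hε 1 ((1 + 3 * β) / 4)
    rw [Real.rpow_one] at h_sub
    rw [← h_sub]
    ring_nf
  rw [Real.sqrt_mul hD, h_sqrt, ← h_quot, ← mul_assoc, div_mul_eq_div_div, inv_mul_eq_div,
    div_right_comm]

theorem eventually_mul_rpow_le_rpow {a c γ K : ℝ} (ha : a ≤ 0) (hc : 0 < c) (hγ : 0 < γ)
    (hK : 0 < K) {R : ℝ → ℝ} (hR₀ : ∀ᶠ ε : ℝ in 𝓝[>] 0, 0 < R ε)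
    (hRK : ∀ᶠ ε : ℝ in 𝓝[>] 0, R ε ≤ K * Real.log (1 / ε)) :
    ∀ᶠ ε : ℝ in 𝓝[>] 0, c * ε ^ γ ≤ R ε ^ a := by
  filter_upwards [hR₀, hRK, tendsto_log_one_div.eventually_gt_atTop 0, self_mem_nhdsWithin,
    tendsto_log_one_div.eventually
      (eventually_log_add_le (-a) (Real.log c - a * Real.log K) hγ)]
    with ε hR hRK h_log (hε : 0 < ε) h_loglog
  have h_inv : Real.log (1 / ε) = -Real.log ε := by rw [one_div, Real.log_inv]
  calc c * ε ^ γ = Real.exp (Real.log (c * ε ^ γ)) := (Real.exp_log (by positivity)).symm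
    _ ≤ Real.exp (Real.log ((K * Real.log (1 / ε)) ^ a)) := by
        rw [Real.exp_le_exp, Real.log_rpow (by positivity), Real.log_mul hK.ne' h_log.ne',
          Real.log_mul hc.ne' (Real.rpow_pos_of_pos hε γ).ne', Real.log_rpow hε]
        linarith [congrArg (γ * ·) h_inv]
    _ = (K * Real.log (1 / ε)) ^ a := Real.exp_log (by positivity)
    _ ≤ R ε ^ a := Real.rpow_le_rpow_of_nonpos hR hRK ha

theorem C1_div_C2_pos (φ₀ : ℝ → ℂ) (g₀ : L2) : 0 < C1 φ₀ g₀ / C2 g₀ := by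
  unfold C1 C2
  positivity

theorem measurableSet_abs_le_and_norm_truncHat_le {φ : ℝ → ℂ} (hφ : Integrable φ)
    (s R m : ℝ) : MeasurableSet {x : ℝ | |x| ≤ R ∧ ‖truncHat φ s x‖ ≤ m} := by
  have h_cont : Continuous fun x : ℝ => truncHat φ s x :=
    (differentiable_truncHat hφ s).continuous.comp Complex.continuous_ofReal
  exact ((isClosed_le continuous_abs continuous_const).inter
    (isClosed_le h_cont.norm continuous_const)).measurableSet

theorem nonneg_of_ae_norm_sq_le {u : ℝ → ℂ} {C q : ℝ}
    (hu : ∀ᵐ x : ℝ, ‖u x‖ ^ 2 ≤ C * (1 + x ^ 2) ^ (-q)) : 0 ≤ C := by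
  obtain ⟨x, hx⟩ := hu.exists
  exact nonneg_of_mul_nonneg_left ((sq_nonneg _).trans hx) (by positivity)

section Error

variable {φ₀ : ℝ → ℂ} {β q C : ℝ}

theorem norm_hat_sub_truncHat_cutoff_le (hφ₀ : Integrable φ₀)
    (hp : Tendsto (fun s : ℝ => p φ₀ s / (s : EReal)) atTop (𝓝 ⊤)) {ε : ℝ} (hε : 0 < ε) (x : ℝ) :
    ‖hat φ₀ x - truncHat φ₀ (cutoff φ₀ ε) x‖ ≤ ε :=
  (norm_hat_sub_truncHat_le hφ₀ _ x).trans
    (setIntegral_compl_Icc_cutoff_le hφ₀.aestronglyMeasurable hp hε)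

theorem eventually_volume_truncHat_le (hβ₀ : 0 < β) (hβ₁ : β ≤ 1) (hq : 0 ≤ q)
    (hφ₀ : Integrable φ₀) (h0 : ¬ φ₀ =ᵐ[volume] 0)
    (hp : Tendsto (fun s : ℝ => p φ₀ s / (s : EReal)) atTop (𝓝 ⊤)) {R : ℝ → ℝ}
    (hR : ∀ᶠ ε : ℝ in 𝓝[>] 0, IsRadius φ₀ q β ε (R ε)) :
    ∀ᶠ ε : ℝ in 𝓝[>] 0,
      volume {x : ℝ | |x| ≤ R ε ∧ ‖truncHat φ₀ (cutoff φ₀ ε) x‖ ≤ ε ^ β + ε} ≤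
        ENNReal.ofReal (R ε ^ (1 - 2 * q)) := by
  obtain ⟨s₁, hs₁, h_cutoff⟩ := exists_eventually_le_cutoff hφ₀.aestronglyMeasurable h0 hp
  obtain ⟨x₀, hx₀⟩ := exists_hat_ne_zero hφ₀ h0
  have ha : 0 < ‖hat φ₀ x₀‖ / 2 := by positivity
  filter_upwards [hR, h_cutoff, Ioo_mem_nhdsGT ha, (tendsto_radius hq hβ₀ hβ₁ hp hR).eventually
    (eventually_volume_small_le hq hs₁ ha (norm1 φ₀) x₀)]
    with ε ⟨_, _, h_eq⟩ hs ⟨hε, hεa⟩ h_remez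
  have h_lower : ‖hat φ₀ x₀‖ / 2 ≤ ‖truncHat φ₀ (cutoff φ₀ ε) x₀‖ := by
    linarith [norm_le_norm_add_norm_sub' (hat φ₀ x₀) (truncHat φ₀ (cutoff φ₀ ε) x₀),
      norm_hat_sub_truncHat_cutoff_le hφ₀ hp hε x₀]
  have h_exp : Real.exp (-radiusFun q (Real.log (norm1 φ₀)) (cutoff φ₀ ε) (R ε)) = ε ^ β + ε := by
    rw [show radiusFun q _ _ _ = _ from h_eq, neg_neg, Real.exp_log (by positivity)]
  exact h_exp ▸ h_remez _ hs _ (differentiable_truncHat hφ₀ _) (norm_truncHat_le hφ₀ _) h_lower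

theorem eventually_norm_sub_le_of_isTikhonov (hβ₀ : 0 < β) (hβ₁ : β < 1) (hq : 1 / 2 < q)
    (hφ₀ : Integrable φ₀) (h0 : ¬ φ₀ =ᵐ[volume] 0) {f₀ g₀ : L2} (hsol : IsSolution φ₀ f₀ g₀)
    (hdecay : ∀ᵐ x : ℝ, ‖hat2 f₀ x‖ ^ 2 ≤ C * (1 + x ^ 2) ^ (-q))
    (hp : Tendsto (fun s : ℝ => p φ₀ s / (s : EReal)) atTop (𝓝 ⊤)) {R : ℝ → ℝ}
    (hR : ∀ᶠ ε : ℝ in 𝓝[>] 0, IsRadius φ₀ q β ε (R ε)) :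
    ∀ᶠ ε : ℝ in 𝓝[>] 0, ∀ (δ : ℝ) (φ : ℝ → ℂ) (g f : L2), 0 < δ → Integrable φ →
      norm1 (φ₀ - φ) ≤ ε → ‖g₀ - g‖ ≤ ε → IsTikhonov δ φ g f →
      ‖f₀ - f‖ ≤ √(C * (2 / (2 * q - 1) + 1)) * R ε ^ (-q + 1 / 2) +
        (δ / (ε ^ β / 2) ^ 2 + ε / (2 * √δ)) * ‖f₀‖ + ε / (2 * √δ) := by
  have hC := nonneg_of_ae_norm_sq_le hdecay
  filter_upwards [hR, eventually_volume_truncHat_le hβ₀ hβ₁.le (by linarith) hφ₀ h0 hp hR,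
    eventually_two_mul_le_rpow hβ₁, self_mem_nhdsWithin]
    with ε ⟨hR₀, _, _⟩ hvol h_two (hε : 0 < ε) δ φ g f hδ hφ hφε hgε hf
  let E := {x : ℝ | |x| ≤ R ε ∧ ‖truncHat φ₀ (cutoff φ₀ ε) x‖ ≤ ε ^ β + ε}
  have hE : MeasurableSet E := measurableSet_abs_le_and_norm_truncHat_le hφ₀ _ _ _
  have h_large : ∀ x ∉ {x : ℝ | R ε < |x|} ∪ E, ε ^ β / 2 ≤ ‖hat φ x‖ := fun x hx => by
    obtain ⟨hxR, hxE⟩ := not_or.1 hx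
    have h_trunc : ε ^ β + ε < ‖truncHat φ₀ (cutoff φ₀ ε) x‖ :=
      not_le.1 fun h => hxE ⟨not_lt.1 hxR, h⟩
    linarith [norm_hat_sub_truncHat_cutoff_le hφ₀ hp hε x, norm_hat_sub_hat_le hφ₀ hφ x,
      norm_sub_norm_le (truncHat φ₀ (cutoff φ₀ ε) x) (hat φ₀ x),
      norm_sub_rev (truncHat φ₀ (cutoff φ₀ ε) x) (hat φ₀ x),
      norm_sub_norm_le (hat φ₀ x) (hat φ x)]
  exact norm_sub_le_of_isTikhonov hφ₀ hφ hδ (by positivity) (by positivity) hsol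
    ((measurableSet_lt measurable_const measurable_id.abs).union hE)
    (eLpNorm_indicator_le hq hR₀ hC hdecay hE hvol) h_large hφε hgε hf

theorem exists_norm_sub_le_mul_radius_rpow (hβ₀ : 0 < β) (hβ₁ : β < 1) (hq : 1 / 2 < q)
    (hφ₀ : Integrable φ₀) (h0 : ¬ φ₀ =ᵐ[volume] 0) {f₀ g₀ : L2} (hsol : IsSolution φ₀ f₀ g₀)
    (hdecay : ∀ᵐ x : ℝ, ‖hat2 f₀ x‖ ^ 2 ≤ C * (1 + x ^ 2) ^ (-q))
    (hp : Tendsto (fun s : ℝ => p φ₀ s / (s : EReal)) atTop (𝓝 ⊤)) {R : ℝ → ℝ}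
    (hR : ∀ᶠ ε : ℝ in 𝓝[>] 0, IsRadius φ₀ q β ε (R ε)) :
    ∃ C₃ : ℝ, 0 < C₃ ∧ ∀ᶠ ε : ℝ in 𝓝[>] 0, ∀ (φ : ℝ → ℂ) (g f : L2), Integrable φ →
      norm1 (φ₀ - φ) ≤ ε → ‖g₀ - g‖ ≤ ε → IsTikhonov (delta φ₀ g₀ β ε) φ g f →
      ‖f₀ - f‖ ≤ C₃ * R ε ^ (-q + 1 / 2) := by
  obtain ⟨K, hK, hRK⟩ := exists_radius_le_mul_log (by linarith) hβ₀ hβ₁.le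
    hφ₀.aestronglyMeasurable h0 hp hR
  let D := (C1 φ₀ g₀ / C2 g₀) ^ (1 / 4 : ℝ)
  have hD : 0 < D := Real.rpow_pos_of_pos (C1_div_C2_pos φ₀ g₀) _
  have h_power : ∀ {c γ : ℝ}, 0 < c → 0 < γ →
      ∀ᶠ ε : ℝ in 𝓝[>] 0, c * ε ^ γ ≤ R ε ^ (-q + 1 / 2) := fun hc hγ =>
    eventually_mul_rpow_le_rpow (by linarith) hc hγ hK (hR.mono fun _ h => h.1) hRK
  refine ⟨√(C * (2 / (2 * q - 1) + 1)) + 2 * ‖f₀‖ + 1, by positivity, ?_⟩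
  filter_upwards [eventually_norm_sub_le_of_isTikhonov hβ₀ hβ₁ hq hφ₀ h0 hsol hdecay hp hR,
    h_power (show 0 < 4 * D by positivity) (show 0 < (1 - β) / 2 by linarith),
    h_power (show 0 < (2 * √D)⁻¹ by positivity) (show 0 < 3 * (1 - β) / 4 by linarith),
    self_mem_nhdsWithin] with ε h_error h_bias h_noise (hε : 0 < ε) φ g f hφ hφε hgε hf
  have h_le := h_error (D * ε ^ ((1 + 3 * β) / 2)) φ g f (by positivity) hφ hφε hgε hf
  rw [mul_rpow_div_sq D β hε, div_two_mul_sqrt_mul_rpow hD.le β hε] at h_le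
  linarith [mul_le_mul_of_nonneg_right (add_le_add h_bias h_noise) (norm_nonneg f₀)]

end Error

end Deconvolution

theorem theorem2_general
    (β q C : ℝ) (hβ₀ : 0 < β) (hβ₁ : β < 1) (hq : 1 / 2 < q)
    (φ₀ : ℝ → ℂ) (hφ₀ : Integrable φ₀ volume) (hφ₀_ne : ¬ φ₀ =ᵐ[volume] 0)
    (f₀ g₀ : Deconvolution.L2)
    (hsol : Deconvolution.IsSolution φ₀ f₀ g₀)
    (hdecay : ∀ᵐ x : ℝ, ‖Deconvolution.hat2 f₀ x‖ ^ 2 ≤ C * (1 + x ^ 2) ^ (-q))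
    (hp : Tendsto (fun s : ℝ => Deconvolution.p φ₀ s / (s : EReal)) atTop (𝓝 ⊤)) :
    (∀ᶠ ε : ℝ in 𝓝[>] 0, ∃! R : ℝ, Deconvolution.IsRadius φ₀ q β ε R) ∧
    ∀ R : ℝ → ℝ, (∀ᶠ ε : ℝ in 𝓝[>] 0, Deconvolution.IsRadius φ₀ q β ε (R ε)) →
      Tendsto R (𝓝[>] 0) atTop ∧
      (∃ C₃ : ℝ, 0 < C₃ ∧ ∀ᶠ ε : ℝ in 𝓝[>] 0,
        ∀ (φ : ℝ → ℂ) (g f : Deconvolution.L2), Integrable φ volume →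
          Deconvolution.norm1 (φ₀ - φ) ≤ ε → ‖g₀ - g‖ ≤ ε →
          Deconvolution.IsTikhonov (Deconvolution.delta φ₀ g₀ β ε) φ g f →
          ‖f₀ - f‖ ≤ C₃ * (R ε) ^ (-q + 1 / 2)) ∧
      (Deconvolution.HasCompactSupp φ₀ →
        (∃ M : ℝ, ∀ᶠ ε : ℝ in 𝓝[>] 0, |Deconvolution.cutoff φ₀ ε| ≤ M) ∧
        Tendsto (fun ε : ℝ => Real.log (R ε) / Real.log (Real.log (1 / ε))) (𝓝[>] 0) (𝓝 1)) := by
  have hq₀ : 0 ≤ q := by linarith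
  have hφ₀_meas := hφ₀.aestronglyMeasurable
  refine ⟨Deconvolution.eventually_existsUnique_isRadius hq₀ hβ₀ hβ₁.le hφ₀_meas hφ₀_ne hp,
    fun R hR => ⟨Deconvolution.tendsto_radius hq₀ hβ₀ hβ₁.le hp hR,
      Deconvolution.exists_norm_sub_le_mul_radius_rpow hβ₀ hβ₁ hq hφ₀ hφ₀_ne hsol hdecay hp hR,
      fun hsupp => ?_⟩⟩
  obtain ⟨M, hM⟩ := Deconvolution.exists_cutoff_le_of_hasCompactSupp hsupp
  refine ⟨⟨M, Eventually.of_forall fun ε => ?_⟩,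
    Deconvolution.tendsto_log_radius_div hq₀ hβ₀ hβ₁.le hφ₀_meas hφ₀_ne hp hM hR⟩
  exact (abs_of_nonneg (Deconvolution.cutoff_nonneg φ₀ ε)).trans_le (hM ε)

theorem theorem2
    (β q C : ℝ) (hβ₀ : 0 < β) (hβ₁ : β < 1 / 3) (hq : 1 / 2 < q)
    (φ₀ : ℝ → ℂ) (hφ₀ : Integrable φ₀ volume) (hφ₀_ne : ¬ φ₀ =ᵐ[volume] 0)
    (f₀ g₀ : Deconvolution.L2)
    (hsol : Deconvolution.IsSolution φ₀ f₀ g₀)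
    (hdecay : ∀ᵐ x : ℝ, ‖Deconvolution.hat2 f₀ x‖ ^ 2 ≤ C * (1 + x ^ 2) ^ (-q))
    (hp : Tendsto (fun s : ℝ => Deconvolution.p φ₀ s / (s : EReal)) atTop (𝓝 ⊤)) :
    -- for small `ε` the equation for `R_ε` has a solution, and only one
    (∀ᶠ ε : ℝ in 𝓝[>] 0, ∃! R : ℝ, Deconvolution.IsRadius φ₀ q β ε R) ∧
    ∀ R : ℝ → ℝ, (∀ᶠ ε : ℝ in 𝓝[>] 0, Deconvolution.IsRadius φ₀ q β ε (R ε)) →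
      Tendsto R (𝓝[>] 0) atTop ∧
      (∃ C₃ : ℝ, 0 < C₃ ∧ ∀ᶠ ε : ℝ in 𝓝[>] 0,
        ∀ (φ : ℝ → ℂ) (g f : Deconvolution.L2), Integrable φ volume →
          Deconvolution.norm1 (φ₀ - φ) ≤ ε → ‖g₀ - g‖ ≤ ε →
          Deconvolution.IsTikhonov (Deconvolution.delta φ₀ g₀ β ε) φ g f →
          ‖f₀ - f‖ ≤ C₃ * (R ε) ^ (-q + 1 / 2)) ∧
      (Deconvolution.HasCompactSupp φ₀ →
        (∃ M : ℝ, ∀ᶠ ε : ℝ in 𝓝[>] 0, |Deconvolution.cutoff φ₀ ε| ≤ M) ∧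
        Tendsto (fun ε : ℝ => Real.log (R ε) / Real.log (Real.log (1 / ε))) (𝓝[>] 0) (𝓝 1)) :=
  theorem2_general β q C hβ₀ (by linarith) hq φ₀ hφ₀ hφ₀_ne f₀ g₀ hsol hdecay hp
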